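/- For integers $\ell\ge 1$, $n\ge 0$ let $$N_\ell(n)=\frac{1}{n!}\,\bigl|\{(\pi_1,\dots,\pi_\ell)\in S_n^{\ell} : \pi_j\pi_k=\pi_k\pi_j \text{ for all } 1\le j,k\le \ell\}\bigr|,$$ where $S_n$ is the symmetric group on $n$ letters (so $N_\ell(0)=1$), and let $$\Delta_{a,b}^{\ell}=N_\ell(a)\,N_\ell(b)-N_\ell(a+b).$$ **Theorem.** Let $a\ge 1$, $b\ge 2$ and $\ell\ge 1$ be integers. 1. Let $b\equiv a\equiv 0 \pmod 3$. Then $\Delta_{a,b}^{\ell}>0$ for $$\ell>1+\frac{a+b}{3}\log_{9/8}\left(4\,\frac{a+b}{3}\right).$$ 2. Let $b\equiv 1\pmod 3$. (i) Let $b>4$ and $a\equiv 0\pmod 3$. Then $\Delta_{a,b}^{\ell}>0$ for $$\ell\ge \log_{9/8}\left(\frac76\right)+\frac{a+b-2}{3}\log_{9/8}(4)+\frac{a+b-4}{3}\log_{9/8}\left(\frac{a+b-4}{3}\right).$$ (ii) Let $b>1$ and $a\equiv 1\pmod 3$. Then $\Delta_{a,b}^{\ell}<0$ for $$\ell\ge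 -6+9(a+b)+\frac{(a+b)/2+2}{3}\log_{9/8}\left(\frac{a+b-2}{3}\right).$$ 3. Let $b\equiv 2\pmod 3$. (i) Let $b>2$ and $a\equiv 0\pmod 3$. Then $\Delta_{a,b}^{\ell}>0$ for $$\ell\ge 1+\frac{a+b-1}{3}\log_{9/8}(4)+\frac{a+b-2}{3}\log_{9/8}\left(\frac{a+b-2}{3}\right).$$ (ii) Let $a\equiv 1\pmod 3$ and $a>1$. Then $\Delta_{a,b}^{\ell}<0$ for $$\ell\ge 5+9(a+b)+\frac{(a+b)/2+4}{3}\log_{9/8}\left(\frac{a+b}{3}\right).$$ (iii) Let $a,b>2$ and $a\equiv 2\pmod 3$. Then $\Delta_{a,b}^{\ell}>0$ for $$\ell\ge 1+\log_{9/8}\left(\frac76\right)+\left(\frac{a+b-4}{3}+a+b\right)\log_{9/8}(2).$$ -/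

import Mathlib

/-- `C_{ℓ,n}`: the `ℓ`-tuples of pairwise commuting permutations of `n` letters. -/
def commutingTuples (ℓ n : ℕ) : Set (Fin ℓ → Equiv.Perm (Fin n)) :=
  {π | ∀ j k : Fin ℓ, π j * π k = π k * π j}

/-- `N_ℓ(n) = |C_{ℓ,n}| / n!`; for `n = 0` this is `1`. -/
noncomputable def commN (ℓ n : ℕ) : ℝ :=
  (Nat.card (commutingTuples ℓ n) : ℝ) / (n.factorial : ℝ)

/-- `Δ_{a,b}^ℓ = N_ℓ(a) N_ℓ(b) - N_ℓ(a+b)`. -/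
noncomputable def bessenrodtOnoDelta (ℓ a b : ℕ) : ℝ :=
  commN ℓ a * commN ℓ b - commN ℓ (a + b)

/-! Commuting `ℓ`-tuples in S_n are actions of ℤ^ℓ on n points, so the orbit decomposition gives ∑
N_ℓ(n) t^n = exp(∑ w_k t^k / k), where w_k (`transitiveWeight`) counts transitive actions on k
points, divided by (k-1)!. It is bounded above by the number of index-k subgroups of ℤ^ℓ, roughly
k^ℓ.

For large `ℓ` the size of a coefficient is governed by k^(1/k), which is largest at k = 3; then k =
2 and k = 4 tie at √2. Split off u = w_3 / 3, about 3^ℓ / 6, and measure the rest in powers of q =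
√2^ℓ: N_ℓ(n) = ∑ u^i / i! · x_{n-3i} q^{n-3i} with x bounded (`CubeDominated`,
`exists_cubeDominated`). Trading one more factor u for q^3 costs ρ = q^3 / u, and ρ^2 ≤ 37 (8/9)^ℓ
(`ratio_sq_le`); hence the base 9/8.

The main terms are u^K / K! for n = 3K, u^K / K! · q^2 / 2 for n = 3K + 2, and u^K / K! · x_4 q^4
for n = 3K + 4: residue 1 must give up one 3 to form 4. When the remainders 0, 2, 4 simply add up,
N(a) N(b) and N(a+b) carry the same powers of u and q, and the product wins because (i+j)! / (i! j!)
≥ 2. For residues (1,1) and (1,2) the sum can use two more 3s than the product, so the product is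
smaller by ρ^2 up to an exponential factor in K, which a linear lower bound on `ℓ` absorbs. -/

open Equiv

/-! ### Commuting tuples as actions of ℤ^ℓ, and the orbit recursion -/

/-- Commuting `ℓ`-tuples of permutations are the actions of `ℤ^ℓ`. -/
def commutingTuplesEquivHom (ℓ n : ℕ) :
    commutingTuples ℓ n ≃ ((Fin ℓ → Multiplicative ℤ) →* Perm (Fin n)) :=
  (Equiv.subtypeEquiv (Equiv.piCongrRight fun _ => zpowersHom (Perm (Fin n))) (fun π => by
    constructor
    · intro h i j _ x y
      simp only [Equiv.piCongrRight_apply, Pi.map_apply, zpowersHom_apply]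
      exact Commute.zpow_zpow (h i j) _ _
    · intro h j k
      by_cases hjk : j = k
      · rw [hjk]
      · have := h hjk (Multiplicative.ofAdd 1) (Multiplicative.ofAdd 1)
        simpa [Equiv.piCongrRight_apply, zpowersHom_apply, commute_iff_eq] using this)).trans
    (MonoidHom.noncommPiCoprodEquiv (N := fun _ : Fin ℓ => Multiplicative ℤ)
      (M := Perm (Fin n)))

/-- The orbit of a point under an action given as a homomorphism to permutations. -/
def homOrbit {G α : Type*} [Group G] (f : G →* Perm α) (x : α) : Set α :=
  Set.range fun g => f g x

/-- The transitive actions of `G` on `α`. -/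
def transitiveHoms (G α : Type*) [Group G] : Set (G →* Perm α) :=
  {f | ∀ x y, ∃ g, f g x = y}

section orbits

variable {G α : Type*} [Group G]

lemma mem_homOrbit_self (f : G →* Perm α) (x : α) : x ∈ homOrbit f x := ⟨1, by simp⟩

lemma map_mem_homOrbit_iff (f : G →* Perm α) (x a : α) (g : G) :
    f g a ∈ homOrbit f x ↔ a ∈ homOrbit f x := by
  constructor
  · rintro ⟨h, hh⟩
    refine ⟨g⁻¹ * h, ?_⟩
    simp only at hh
    simp [Perm.mul_apply, hh]
  · rintro ⟨h, rfl⟩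
    exact ⟨g * h, by simp [Perm.mul_apply]⟩

/-- An action with prescribed orbit `{a | p a}` is a transitive action on the orbit together with an
arbitrary action on its complement. -/
noncomputable def homsWithOrbitEquiv (p : α → Prop) [DecidablePred p] (x : α) (hx : p x) :
    transitiveHoms G {a // p a} × (G →* Perm {a // ¬ p a}) ≃
      {f : G →* Perm α // homOrbit f x = {a | p a}} := by
  refine Equiv.ofBijective (fun f => ⟨(Perm.subtypeCongrHom p).comp (f.1.1.prod f.2), ?_⟩) ⟨?_, ?_⟩
  · ext a
    simp only [homOrbit, Set.mem_range, Set.mem_ofPred_eq]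
    constructor
    · rintro ⟨g, rfl⟩
      simp [hx, (f.1.1 g ⟨x, hx⟩).2]
    · intro ha
      obtain ⟨g, hg⟩ := f.1.2 ⟨x, hx⟩ ⟨a, ha⟩
      exact ⟨g, by simp [hx, hg]⟩
  · rintro ⟨⟨f, hf⟩, f'⟩ ⟨⟨k, hk⟩, k'⟩ h
    have h' : ∀ g, (f g, f' g) = (k g, k' g) := fun g =>
      Perm.subtypeCongrHom_injective p (DFunLike.congr_fun (Subtype.ext_iff.1 h) g)
    have h1 : f = k := by ext1 g; exact congrArg Prod.fst (h' g)
    have h2 : f' = k' := by ext1 g; exact congrArg Prod.snd (h' g)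
    subst h1 h2
    rfl
  · rintro ⟨f, hf⟩
    have hp : ∀ g a, p (f g a) ↔ p a := fun g a => by
      have := map_mem_homOrbit_iff f x a g
      rwa [hf] at this
    let f₁ : G →* Perm {a // p a} :=
      { toFun := fun g => (f g).subtypePerm (hp g)
        map_one' := by ext; simp
        map_mul' := fun g h => by ext; simp only [map_mul]; rfl }
    let f₂ : G →* Perm {a // ¬ p a} :=
      { toFun := fun g => (f g).subtypePerm (fun a => not_congr (hp g a))
        map_one' := by ext; simp
        map_mul' := fun g h => by ext; simp only [map_mul]; rfl }
    refine ⟨⟨⟨f₁, ?_⟩, f₂⟩, ?_⟩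
    · rintro ⟨a, ha⟩ ⟨b, hb⟩
      have ha' : a ∈ homOrbit f x := by rw [hf]; exact ha
      have hb' : b ∈ homOrbit f x := by rw [hf]; exact hb
      obtain ⟨g, rfl⟩ := ha'
      obtain ⟨h, rfl⟩ := hb'
      exact ⟨h * g⁻¹, by ext; simp [f₁]⟩
    · ext g a
      by_cases ha : p a <;> simp [ha, f₁, f₂]

lemma card_transitiveHoms_congr {β : Type*} (e : α ≃ β) :
    Nat.card (transitiveHoms G α) = Nat.card (transitiveHoms G β) := by
  refine Nat.card_congr (Equiv.subtypeEquiv e.permCongrHom.monoidHomCongrRightEquiv fun f => ?_)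
  change (∀ x y, _) ↔ (∀ x y, ∃ g, e (f g (e.symm x)) = y)
  constructor
  · intro h x y
    obtain ⟨g, hg⟩ := h (e.symm x) (e.symm y)
    exact ⟨g, by simp [hg]⟩
  · intro h x y
    obtain ⟨g, hg⟩ := h (e x) (e y)
    exact ⟨g, by simpa using hg⟩

lemma card_hom_congr {β : Type*} (e : α ≃ β) :
    Nat.card (G →* Perm α) = Nat.card (G →* Perm β) :=
  Nat.card_congr e.permCongrHom.monoidHomCongrRightEquiv

end orbits

/-- Counting pairs of an action and a point by the orbit of the point. -/
theorem mul_card_hom_eq_sum (G : Type*) [Group G] (n : ℕ) [Finite (G →* Perm (Fin n))] :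
    n * Nat.card (G →* Perm (Fin n)) =
      ∑ k ∈ Finset.range (n + 1), n.choose k * (k * Nat.card (transitiveHoms G (Fin k)) *
        Nat.card (G →* Perm (Fin (n - k)))) := by
  classical
  have := Fintype.ofFinite (G →* Perm (Fin n))
  have key : ∀ x : Fin n, Nat.card (G →* Perm (Fin n)) =
      ∑ S : Finset (Fin n), if x ∈ S then Nat.card (transitiveHoms G (Fin S.card)) *
        Nat.card (G →* Perm (Fin (n - S.card))) else 0 := by
    intro x
    rw [Nat.card_eq_fintype_card, ← Finset.card_univ,
      Finset.card_eq_sum_card_fiberwise (f := fun f => (homOrbit f x).toFinset)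
        (t := Finset.univ) (by simp)]
    refine Finset.sum_congr rfl fun S _ => ?_
    split_ifs with hx
    · have e := homsWithOrbitEquiv (G := G) (fun a => a ∈ S) x hx
      have c := Nat.card_congr e
      rw [Nat.card_prod] at c
      rw [card_transitiveHoms_congr (S.equivFin)] at c
      have hc : Fintype.card {a // a ∉ S} = n - S.card := by
        simp [Fintype.card_subtype_compl]
      rw [card_hom_congr (Fintype.equivFinOfCardEq hc)] at c
      rw [c, Nat.card_eq_fintype_card, Fintype.card_subtype]
      congr 1
      ext f
      simp only [Finset.mem_filter, Finset.mem_univ, true_and]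
      rw [← Finset.coe_inj]
      simp
    · rw [Finset.card_eq_zero, Finset.filter_eq_empty_iff]
      rintro f - rfl
      exact hx (by simpa using mem_homOrbit_self f x)
  calc n * Nat.card (G →* Perm (Fin n))
      = ∑ x : Fin n, Nat.card (G →* Perm (Fin n)) := by simp
    _ = ∑ x : Fin n, ∑ S : Finset (Fin n), (if x ∈ S then
          Nat.card (transitiveHoms G (Fin S.card)) *
          Nat.card (G →* Perm (Fin (n - S.card))) else 0) :=
        Finset.sum_congr rfl fun x _ => key x
    _ = ∑ S ∈ (Finset.univ : Finset (Fin n)).powerset,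
          S.card * Nat.card (transitiveHoms G (Fin S.card)) *
          Nat.card (G →* Perm (Fin (n - S.card))) := by
        rw [Finset.sum_comm, Finset.powerset_univ]
        refine Finset.sum_congr rfl fun S _ => ?_
        rw [← Finset.sum_filter]
        simp [mul_assoc]
    _ = _ := by
        rw [Finset.sum_powerset_apply_card
          (fun k => k * Nat.card (transitiveHoms G (Fin k)) * Nat.card (G →* Perm (Fin (n - k))))]
        simp

instance (ℓ n : ℕ) : Finite ((Fin ℓ → Multiplicative ℤ) →* Perm (Fin n)) :=
  Finite.of_equiv _ (commutingTuplesEquivHom ℓ n)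

/-- The number of transitive actions of `ℤ^ℓ` on `k` points, divided by `(k - 1)!`. -/
noncomputable def transitiveWeight (ℓ k : ℕ) : ℝ :=
  k * Nat.card (transitiveHoms (Fin ℓ → Multiplicative ℤ) (Fin k)) / k.factorial

lemma transitiveWeight_nonneg (ℓ k : ℕ) : 0 ≤ transitiveWeight ℓ k := by
  unfold transitiveWeight; positivity

lemma transitiveWeight_zero (ℓ : ℕ) : transitiveWeight ℓ 0 = 0 := by simp [transitiveWeight]

lemma commN_eq (ℓ n : ℕ) :
    commN ℓ n = Nat.card ((Fin ℓ → Multiplicative ℤ) →* Perm (Fin n)) / n.factorial := by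
  rw [commN, Nat.card_congr (commutingTuplesEquivHom ℓ n)]

lemma commN_zero (ℓ : ℕ) : commN ℓ 0 = 1 := by
  have : commutingTuples ℓ 0 = Set.univ := by
    ext π; simp [commutingTuples, eq_iff_true_of_subsingleton]
  simp [commN, this]

lemma commN_one (ℓ : ℕ) : commN ℓ 1 = 1 := by
  have : commutingTuples ℓ 1 = Set.univ := by
    ext π; simp [commutingTuples, eq_iff_true_of_subsingleton]
  simp [commN, this]

theorem mul_commN_eq_sum (ℓ n : ℕ) :
    n * commN ℓ n = ∑ k ∈ Finset.range (n + 1), transitiveWeight ℓ k * commN ℓ (n - k) := by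
  have h := mul_card_hom_eq_sum (Fin ℓ → Multiplicative ℤ) n
  have h' := congrArg (Nat.cast : ℕ → ℝ) h
  push_cast at h'
  have hn : (n.factorial : ℝ) ≠ 0 := by positivity
  rw [commN_eq, mul_div_assoc', h', Finset.sum_div]
  refine Finset.sum_congr rfl fun k hk => ?_
  rw [commN_eq, transitiveWeight, Nat.cast_choose ℝ (Nat.lt_succ_iff.1 (Finset.mem_range.1 hk))]
  have h1 : (k.factorial : ℝ) ≠ 0 := by positivity
  have h2 : ((n - k).factorial : ℝ) ≠ 0 := by positivity
  field_simp

/-! ### Transitive actions and subgroups of finite index -/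

/-- The number of subgroups of index `k`. -/
noncomputable def subgroupCount (G : Type*) [Group G] (k : ℕ) : ℕ :=
  Nat.card {H : Subgroup G // H.index = k}

section subgroups

variable {G : Type*} [Group G]

/-- A transitive action of `G` with a base point is a labelling of some `G ⧸ H`. -/
theorem mul_card_transitiveHoms_le {k : ℕ} (hk : k ≠ 0) [Finite {H : Subgroup G // H.index = k}] :
    k * Nat.card (transitiveHoms G (Fin k)) ≤ k.factorial * subgroupCount G k := by
  have := Fintype.ofFinite {H : Subgroup G // H.index = k}
  have hfin : ∀ H : {H : Subgroup G // H.index = k}, Nonempty (G ⧸ H.1 ≃ Fin k) := fun H => by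
    have : Nat.card (G ⧸ H.1) = k := H.2
    have := Nat.finite_of_card_ne_zero (this.trans_ne hk)
    exact ⟨Finite.equivFinOfCardEq ‹_›⟩
  have hfin' : ∀ H : {H : Subgroup G // H.index = k}, Finite (G ⧸ H.1 ≃ Fin k) := fun H => by
    have := Finite.of_equiv _ (hfin H).some.symm
    infer_instance
  let Φ : (Σ H : {H : Subgroup G // H.index = k}, (G ⧸ H.1 ≃ Fin k)) →
      Fin k × transitiveHoms G (Fin k) := fun p =>
    ⟨p.2 (1 : G), p.2.permCongrHom.toMonoidHom.comp (MulAction.toPermHom G (G ⧸ p.1.1)), by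
      intro x y
      obtain ⟨a, ha⟩ := QuotientGroup.mk_surjective (p.2.symm x)
      obtain ⟨b, hb⟩ := QuotientGroup.mk_surjective (p.2.symm y)
      refine ⟨b * a⁻¹, ?_⟩
      change p.2 ((b * a⁻¹) • p.2.symm x) = y
      rw [← ha, MulAction.Quotient.smul_mk, smul_eq_mul, inv_mul_cancel_right, hb, apply_symm_apply]⟩
  -- Surjectivity suffices for an upper bound: a pair (x, f) comes from the stabilizer of x,
  -- labelled through the orbit map.
  have hΦ : Function.Surjective Φ := by
    rintro ⟨x, f, hf⟩
    let _ : MulAction G (Fin k) := MulAction.compHom (Fin k) f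
    have hsmul : ∀ (g : G) (y : Fin k), g • y = f g y := fun _ _ => rfl
    have : MulAction.IsPretransitive G (Fin k) := ⟨hf⟩
    have hidx : (MulAction.stabilizer G x).index = k := by
      rw [MulAction.index_stabilizer_of_transitive, Nat.card_fin]
    let φ : G ⧸ MulAction.stabilizer G x ≃ Fin k :=
      Equiv.ofBijective (MulAction.ofQuotientStabilizer G x)
        ⟨MulAction.injective_ofQuotientStabilizer G x, fun y => by
          obtain ⟨g, hg⟩ := hf x y
          exact ⟨g, hg⟩⟩
    refine ⟨⟨⟨_, hidx⟩, φ⟩, Prod.ext (one_smul G x) (Subtype.ext ?_)⟩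
    ext1 g
    refine Equiv.ext fun y => ?_
    change MulAction.ofQuotientStabilizer G x (g • φ.symm y) = f g y
    rw [MulAction.ofQuotientStabilizer_smul, hsmul]
    exact congrArg (f g) (φ.apply_symm_apply y)
  calc k * Nat.card (transitiveHoms G (Fin k)) = Nat.card (Fin k × transitiveHoms G (Fin k)) := by
        rw [Nat.card_prod, Nat.card_fin]
    _ ≤ Nat.card (Σ H : {H : Subgroup G // H.index = k}, (G ⧸ H.1 ≃ Fin k)) :=
        Nat.card_le_card_of_surjective Φ hΦ
    _ = k.factorial * subgroupCount G k := by
        rw [Nat.card_sigma, Finset.sum_congr rfl (fun H _ => (?_ : _ = k.factorial))]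
        · simp [subgroupCount, mul_comm]
        · rw [Nat.card_congr (Equiv.equivCongr (hfin H).some (Equiv.refl (Fin k)))]
          rw [Nat.card_perm, Nat.card_fin]

end subgroups

lemma index_zpowers_ofAdd (e : ℤ) :
    (Subgroup.zpowers (Multiplicative.ofAdd e)).index = e.natAbs :=
  Int.index_zmultiples e

lemma subgroup_multiplicative_int_eq (M : Subgroup (Multiplicative ℤ)) (hM : M.index ≠ 0) :
    M = Subgroup.zpowers (Multiplicative.ofAdd (M.index : ℤ)) := by
  have hle : Subgroup.zpowers (Multiplicative.ofAdd (M.index : ℤ)) ≤ M := by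
    rw [Subgroup.zpowers_le]
    have := M.pow_index_mem (Multiplicative.ofAdd (1 : ℤ))
    rwa [← ofAdd_nsmul, nsmul_eq_mul, mul_one] at this
  have h := Subgroup.relIndex_mul_index hle
  rw [index_zpowers_ofAdd, Int.natAbs_natCast, mul_eq_right₀ hM, Subgroup.relIndex_eq_one] at h
  exact le_antisymm h hle

/-! ### Subgroups of finite index in G × ℤ -/

section product

variable {G : Type*} [CommGroup G]

/-- The range of `inl` is the kernel of `snd`, so the two factors are the relative indices in the
chain H ≤ H ⊔ ker snd ≤ G × ℤ. -/
lemma index_eq_comap_mul_map (H : Subgroup (G × Multiplicative ℤ)) :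
    H.index = (H.comap (MonoidHom.inl G (Multiplicative ℤ))).index *
      (H.map (MonoidHom.snd G (Multiplicative ℤ))).index := by
  have hr : (MonoidHom.inl G (Multiplicative ℤ)).range = (MonoidHom.snd G (Multiplicative ℤ)).ker := by
    ext ⟨a, b⟩
    simp [Subgroup.mem_prod, eq_comm]
  rw [Subgroup.index_comap, Subgroup.index_map, hr,
    MonoidHom.range_eq_top_of_surjective _ Prod.snd_surjective, Subgroup.index_top, mul_one,
    ← Subgroup.relIndex_mul_index (le_sup_left : H ≤ H ⊔ (MonoidHom.snd G (Multiplicative ℤ)).ker),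
    Subgroup.relIndex_sup_left]

/-- A subgroup `H` of `G × ℤ` of finite index is determined by its intersection with `G`, a coset of
that intersection and the index of its projection to `ℤ`. -/
lemma exists_eq_prod_bot_sup_zpowers (H : Subgroup (G × Multiplicative ℤ)) (hH : H.index ≠ 0) :
    ∃ c : G ⧸ H.comap (MonoidHom.inl G (Multiplicative ℤ)),
      H = (H.comap (MonoidHom.inl G (Multiplicative ℤ))).prod ⊥ ⊔ Subgroup.zpowers (c.out,
        Multiplicative.ofAdd
          ((H.index / (H.comap (MonoidHom.inl G (Multiplicative ℤ))).index : ℕ) : ℤ)) := by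
  have hidx := index_eq_comap_mul_map H
  set K := H.comap (MonoidHom.inl G (Multiplicative ℤ)) with hK
  set M := H.map (MonoidHom.snd G (Multiplicative ℤ)) with hM
  have hK0 : K.index ≠ 0 := fun h => hH (by rw [hidx, h, zero_mul])
  have hM0 : M.index ≠ 0 := fun h => hH (by rw [hidx, h, mul_zero])
  have he : H.index / K.index = M.index := by
    rw [hidx, Nat.mul_div_cancel_left _ (Nat.pos_of_ne_zero hK0)]
  rw [he]
  have hgen := subgroup_multiplicative_int_eq M hM0
  have hmem : Multiplicative.ofAdd (M.index : ℤ) ∈ M := by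
    have h := Subgroup.mem_zpowers (Multiplicative.ofAdd (M.index : ℤ))
    rwa [← hgen] at h
  have hKmem : ∀ x : G, x ∈ K ↔ (x, (1 : Multiplicative ℤ)) ∈ H := fun x => Iff.rfl
  obtain ⟨⟨g, z⟩, hg, hz⟩ := Subgroup.mem_map.1 hmem
  simp only [MonoidHom.coe_snd] at hz
  subst hz
  have hout : ((g : G ⧸ K).out, Multiplicative.ofAdd (M.index : ℤ)) ∈ H := by
    obtain ⟨k, hk⟩ := QuotientGroup.mk_out_eq_mul K g
    rw [hk]
    simpa using H.mul_mem hg ((hKmem _).1 k.2)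
  refine ⟨(g : G ⧸ K), le_antisymm ?_ (sup_le ?_ ?_)⟩
  · rintro ⟨x, z⟩ hx
    have hz : z ∈ M := Subgroup.mem_map.2 ⟨(x, z), hx, rfl⟩
    rw [hgen] at hz
    obtain ⟨j, hj⟩ := Subgroup.mem_zpowers_iff.1 hz
    set w := ((g : G ⧸ K).out, Multiplicative.ofAdd (M.index : ℤ)) with hw
    have hxw : (x, z) = ((x, z) * (w ^ j)⁻¹) * w ^ j := by simp
    rw [hxw]
    refine Subgroup.mul_mem_sup ?_ (Subgroup.zpow_mem _ (Subgroup.mem_zpowers w) j)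
    have hmem' := H.mul_mem hx (H.inv_mem (H.zpow_mem hout j))
    have h2 : ((x, z) * (w ^ j)⁻¹).2 = 1 := by simp [hw, hj]
    refine Subgroup.mem_prod.2 ⟨?_, by rw [h2]; exact Subgroup.mem_bot.2 rfl⟩
    rw [hKmem, ← h2]
    exact hmem'
  · rintro ⟨x, z⟩ hx
    obtain ⟨hx1, hx2⟩ := Subgroup.mem_prod.1 hx
    have : z = 1 := hx2
    subst this
    exact hx1
  · rw [Subgroup.zpowers_le]
    exact hout

/-- The data determining a subgroup of index `k` of `G × ℤ`. -/
abbrev ProdIntSubgroupData (G : Type*) [CommGroup G] (k : ℕ) : Type _ :=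
  Σ d : k.divisors, Σ K : {K : Subgroup G // K.index = (d : ℕ)}, G ⧸ K.1

/-- Ψ rebuilds a subgroup from its data and hits every subgroup of index k. Any choice of preimages
under Ψ is therefore injective; Ψ itself need not be. -/
lemma exists_injective_prodIntSubgroupData {k : ℕ} (hk : k ≠ 0) :
    ∃ F : {H : Subgroup (G × Multiplicative ℤ) // H.index = k} → ProdIntSubgroupData G k,
      Function.Injective F := by
  let Ψ : ProdIntSubgroupData G k → Subgroup (G × Multiplicative ℤ) := fun p =>
    p.2.1.1.prod ⊥ ⊔ Subgroup.zpowers (p.2.2.out, Multiplicative.ofAdd ((k / p.1.1 : ℕ) : ℤ))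
  have h : ∀ H : {H : Subgroup (G × Multiplicative ℤ) // H.index = k}, ∃ p, H.1 = Ψ p := by
    rintro ⟨H, rfl⟩
    obtain ⟨c, hc⟩ := exists_eq_prod_bot_sup_zpowers H hk
    exact ⟨⟨⟨_, Nat.mem_divisors.2 ⟨Dvd.intro _ (index_eq_comap_mul_map H).symm, hk⟩⟩,
      ⟨_, rfl⟩, c⟩, hc⟩
  choose F hF using h
  exact ⟨F, fun H H' e => Subtype.ext (by rw [hF H, hF H', e])⟩

-- Finiteness travels together with the bound because `Nat.card` of an infinite type is 0, which
-- would make the count meaningless.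
variable (G) in
theorem finite_and_subgroupCount_prod_int_le
    (hfin : ∀ k ≠ 0, Finite {H : Subgroup G // H.index = k}) {k : ℕ} (hk : k ≠ 0) :
    Finite {H : Subgroup (G × Multiplicative ℤ) // H.index = k} ∧
      subgroupCount (G × Multiplicative ℤ) k ≤ ∑ d ∈ k.divisors, d * subgroupCount G d := by
  obtain ⟨F, hF⟩ := exists_injective_prodIntSubgroupData (G := G) hk
  have h0 : ∀ d : k.divisors, (d : ℕ) ≠ 0 := fun d => (Nat.pos_of_mem_divisors d.2).ne'
  have h1 : ∀ d : k.divisors, Finite {H : Subgroup G // H.index = (d : ℕ)} :=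
    fun d => hfin d (h0 d)
  have h2 : ∀ (d : k.divisors) (K : {H : Subgroup G // H.index = (d : ℕ)}), Finite (G ⧸ K.1) :=
    fun d K => Nat.finite_of_card_ne_zero (by
      have : Nat.card (G ⧸ K.1) = d := K.2
      rw [this]; exact h0 d)
  refine ⟨Finite.of_injective F hF, (Nat.card_le_card_of_injective F hF).trans_eq ?_⟩
  rw [Nat.card_sigma, ← Finset.sum_coe_sort k.divisors]
  refine Finset.sum_congr rfl fun d _ => ?_
  have := Fintype.ofFinite {H : Subgroup G // H.index = (d : ℕ)}
  rw [Nat.card_sigma, Finset.sum_congr rfl fun K _ => (K.2 : Nat.card (G ⧸ K.1) = (d : ℕ))]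
  simp [subgroupCount, mul_comm]

end product

/-! ### Upper bounds for subgroup counts of ℤ^ℓ -/

/-- Splitting off the first coordinate of `ℤ^(ℓ+1)`. -/
def latticeSuccEquiv (ℓ : ℕ) :
    (Fin (ℓ + 1) → Multiplicative ℤ) ≃* (Fin ℓ → Multiplicative ℤ) × Multiplicative ℤ where
  toFun f := (fun i => f i.succ, f 0)
  invFun p := Fin.cons p.2 p.1
  left_inv f := by
    ext i
    refine Fin.cases ?_ (fun j => ?_) i <;> simp
  right_inv p := by simp
  map_mul' f g := rfl

/-- Isomorphic groups have corresponding subgroups of a given index. -/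
def subgroupIndexEquiv {G H : Type*} [Group G] [Group H] (e : G ≃* H) (k : ℕ) :
    {K : Subgroup G // K.index = k} ≃ {K : Subgroup H // K.index = k} :=
  Equiv.subtypeEquiv e.mapSubgroup.toEquiv fun K => by
    change _ ↔ (K.map (e : G →* H)).index = k
    rw [Subgroup.index_map_equiv]

lemma subgroupCount_one (G : Type*) [Group G] : subgroupCount G 1 = 1 := by
  rw [subgroupCount, Nat.card_eq_one_iff_unique]
  exact ⟨⟨fun H K => Subtype.ext
    ((Subgroup.index_eq_one.1 H.2).trans (Subgroup.index_eq_one.1 K.2).symm)⟩,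
    ⟨⟨⊤, Subgroup.index_top⟩⟩⟩

lemma subgroupCount_lattice_zero {k : ℕ} (hk : k ≠ 1) :
    subgroupCount (Fin 0 → Multiplicative ℤ) k = 0 := by
  have : IsEmpty {H : Subgroup (Fin 0 → Multiplicative ℤ) // H.index = k} :=
    ⟨fun H => hk (H.2.symm.trans (by
      rw [Subgroup.index_eq_one]
      ext x
      simp [Subsingleton.elim x 1]))⟩
  exact Nat.card_of_isEmpty

lemma finite_subgroup_lattice (ℓ : ℕ) : ∀ k ≠ 0,
    Finite {H : Subgroup (Fin ℓ → Multiplicative ℤ) // H.index = k} := by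
  induction ℓ with
  | zero =>
    intro k _
    have : Finite (Subgroup (Fin 0 → Multiplicative ℤ)) :=
      Finite.of_injective (fun H => (H : Set (Fin 0 → Multiplicative ℤ))) SetLike.coe_injective
    infer_instance
  | succ ℓ ih =>
    intro k hk
    have := (finite_and_subgroupCount_prod_int_le _ ih hk).1
    exact Finite.of_equiv _ (subgroupIndexEquiv (latticeSuccEquiv ℓ) k).symm

lemma subgroupCount_lattice_succ_le (ℓ : ℕ) {k : ℕ} (hk : k ≠ 0) :
    subgroupCount (Fin (ℓ + 1) → Multiplicative ℤ) k ≤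
      ∑ d ∈ k.divisors, d * subgroupCount (Fin ℓ → Multiplicative ℤ) d := by
  rw [subgroupCount, Nat.card_congr (subgroupIndexEquiv (latticeSuccEquiv ℓ) k)]
  exact (finite_and_subgroupCount_prod_int_le _ (finite_subgroup_lattice ℓ) hk).2

/-- The divisors of p are 1 and p, so the count obeys s(ℓ+1) ≤ 1 + p s(ℓ), the recursion of the
geometric sum (p^ℓ - 1) / (p - 1). -/
lemma subgroupCount_lattice_prime_le (ℓ : ℕ) {p : ℕ} (hp : p.Prime) :
    (p - 1) * subgroupCount (Fin ℓ → Multiplicative ℤ) p + 1 ≤ p ^ ℓ := by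
  induction ℓ with
  | zero => simp [subgroupCount_lattice_zero hp.ne_one]
  | succ ℓ ih =>
    have h := subgroupCount_lattice_succ_le ℓ hp.ne_zero
    rw [hp.sum_divisors, subgroupCount_one] at h
    obtain ⟨q, rfl⟩ : ∃ q, p = q + 1 := ⟨p - 1, by have := hp.pos; omega⟩
    simp only [Nat.add_sub_cancel] at *
    calc _ ≤ q * ((q + 1) * subgroupCount (Fin ℓ → Multiplicative ℤ) (q + 1) + 1 * 1) + 1 := by
          gcongr
      _ = (q + 1) * (q * subgroupCount (Fin ℓ → Multiplicative ℤ) (q + 1) + 1) := by ring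
      _ ≤ (q + 1) * (q + 1) ^ ℓ := by gcongr
      _ = _ := by ring

/-- The term 2^ℓ is kept to absorb the contribution of index 2 in the induction. Constant 1 before
4^ℓ matters: 4 ties with 2 + 2 on the scale √2^ℓ. -/
lemma subgroupCount_lattice_four_le (ℓ : ℕ) :
    subgroupCount (Fin ℓ → Multiplicative ℤ) 4 + 2 ^ ℓ ≤ 4 ^ ℓ := by
  induction ℓ with
  | zero => simp [subgroupCount_lattice_zero]
  | succ ℓ ih =>
    have h := subgroupCount_lattice_succ_le ℓ (k := 4) (by norm_num)
    have h2 := subgroupCount_lattice_prime_le ℓ Nat.prime_two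
    have hd : Nat.divisors 4 = {1, 2, 4} := by decide
    rw [hd] at h
    simp [subgroupCount_one] at h
    simp at h2
    rw [pow_succ, pow_succ]
    omega

/-- Passing to complementary divisors leaves ∑ e^-(ℓ+1) over e ∣ k. The terms with e ≥ 2 are at most
(1/2)^(ℓ-1) ∑ e^-2, and that last sum is at most 1. -/
lemma sum_divisors_pow_le (ℓ : ℕ) (hℓ : 1 ≤ ℓ) {k : ℕ} (hk : k ≠ 0) :
    ∑ d ∈ k.divisors, (d : ℝ) ^ (ℓ + 1) ≤ k ^ (ℓ + 1) * Real.exp (2 * (1 / 2) ^ ℓ) := by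
  have hk' : (0 : ℝ) < k := by positivity
  obtain ⟨m, rfl⟩ : ∃ m, ℓ = m + 1 := ⟨ℓ - 1, by omega⟩
  have h1 : ∑ d ∈ k.divisors, (d : ℝ) ^ (m + 1 + 1) =
      k ^ (m + 1 + 1) * ∑ e ∈ k.divisors, ((e : ℝ) ^ (m + 2))⁻¹ := by
    rw [← Nat.sum_div_divisors k (fun d => (d : ℝ) ^ (m + 1 + 1)), Finset.mul_sum]
    refine Finset.sum_congr rfl fun e he => ?_
    rw [Nat.cast_div (Nat.dvd_of_mem_divisors he)
      (by exact_mod_cast (Nat.pos_of_mem_divisors he).ne'), div_pow, div_eq_mul_inv]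
  have h2 : ∑ e ∈ k.divisors, ((e : ℝ) ^ (m + 2))⁻¹ ≤ 1 + (1 / 2) ^ m := by
    have hsub : k.divisors ⊆ insert 1 (Finset.Ioc 1 k) := by
      intro e he
      have := Nat.pos_of_mem_divisors he
      have := Nat.divisor_le he
      simp only [Finset.mem_insert, Finset.mem_Ioc]
      omega
    refine (Finset.sum_le_sum_of_subset_of_nonneg hsub fun _ _ _ => by positivity).trans ?_
    rw [Finset.sum_insert (by simp)]
    simp only [Nat.cast_one, one_pow, inv_one]
    gcongr
    calc ∑ e ∈ Finset.Ioc 1 k, ((e : ℝ) ^ (m + 2))⁻¹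
        ≤ ∑ e ∈ Finset.Ioc 1 k, (1 / 2) ^ m * ((e : ℝ) ^ 2)⁻¹ := by
          refine Finset.sum_le_sum fun e he => ?_
          have he' : (2 : ℝ) ≤ e := by exact_mod_cast (Finset.mem_Ioc.1 he).1
          rw [pow_add, mul_inv, ← inv_pow, one_div]
          gcongr
      _ ≤ (1 / 2) ^ m * 1 := by
          rw [← Finset.mul_sum]
          gcongr
          refine (sum_Ioc_inv_sq_le_sub one_ne_zero (Nat.one_le_iff_ne_zero.2 hk)).trans ?_
          simp
      _ = _ := mul_one _
  rw [h1]
  gcongr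
  refine h2.trans ?_
  have := Real.add_one_le_exp (2 * (1 / 2 : ℝ) ^ (m + 1))
  refine le_trans (le_of_eq ?_) this
  ring

/-- Each new coordinate multiplies the constant by exp(2 (1/2)^(ℓ+1)). These exponents sum to the
one displayed, which stays below 2, so the constant is uniform in `ℓ`. -/
lemma subgroupCount_lattice_le_exp (ℓ : ℕ) {k : ℕ} (hk : k ≠ 0) :
    (subgroupCount (Fin (ℓ + 1) → Multiplicative ℤ) k : ℝ) ≤
      Real.exp (2 - 4 * (1 / 2) ^ (ℓ + 1)) * k ^ (ℓ + 1) := by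
  induction ℓ generalizing k with
  | zero =>
    have h := subgroupCount_lattice_succ_le 0 hk
    rw [Finset.sum_eq_single_of_mem 1 (by simp [hk])
      (fun d _ hd => by rw [subgroupCount_lattice_zero hd, mul_zero]), subgroupCount_one] at h
    have h1 : (1 : ℝ) ≤ k := by exact_mod_cast Nat.one_le_iff_ne_zero.2 hk
    have h2 : (subgroupCount (Fin (0 + 1) → Multiplicative ℤ) k : ℝ) ≤ 1 := by exact_mod_cast h
    norm_num
    simpa using h2.trans h1
  | succ ℓ ih =>
    have h : (subgroupCount (Fin (ℓ + 1 + 1) → Multiplicative ℤ) k : ℝ) ≤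
        ∑ d ∈ k.divisors, (d : ℝ) * subgroupCount (Fin (ℓ + 1) → Multiplicative ℤ) d := by
      exact_mod_cast subgroupCount_lattice_succ_le (ℓ + 1) hk
    calc _ ≤ _ := h
      _ ≤ ∑ d ∈ k.divisors, (d : ℝ) * (Real.exp (2 - 4 * (1 / 2) ^ (ℓ + 1)) * d ^ (ℓ + 1)) := by
          refine Finset.sum_le_sum fun d hd => ?_
          gcongr
          exact ih (Nat.pos_of_mem_divisors hd).ne'
      _ = Real.exp (2 - 4 * (1 / 2) ^ (ℓ + 1)) * ∑ d ∈ k.divisors, (d : ℝ) ^ (ℓ + 1 + 1) := by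
          rw [Finset.mul_sum]
          exact Finset.sum_congr rfl fun d _ => by ring
      _ ≤ Real.exp (2 - 4 * (1 / 2) ^ (ℓ + 1)) *
            (k ^ (ℓ + 1 + 1) * Real.exp (2 * (1 / 2) ^ (ℓ + 1))) := by
          gcongr
          exact sum_divisors_pow_le (ℓ + 1) (by omega) hk
      _ = Real.exp (2 - 4 * (1 / 2) ^ (ℓ + 1 + 1)) * k ^ (ℓ + 1 + 1) := by
          rw [mul_left_comm, mul_comm, ← Real.exp_add]
          congr 2
          ring

lemma subgroupCount_lattice_le (ℓ : ℕ) {k : ℕ} (hk : k ≠ 0) :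
    (subgroupCount (Fin ℓ → Multiplicative ℤ) k : ℝ) ≤ 8 * k ^ ℓ := by
  cases ℓ with
  | zero =>
    by_cases h : k = 1
    · simp [h, subgroupCount_one]
    · simp [subgroupCount_lattice_zero h]
  | succ ℓ =>
    refine (subgroupCount_lattice_le_exp ℓ hk).trans ?_
    gcongr
    have h1 : Real.exp (2 - 4 * (1 / 2 : ℝ) ^ (ℓ + 1)) ≤ Real.exp 1 * Real.exp 1 := by
      rw [← Real.exp_add]
      have : (0 : ℝ) ≤ 4 * (1 / 2) ^ (ℓ + 1) := by positivity
      exact Real.exp_le_exp.2 (by linarith)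
    nlinarith [Real.exp_one_lt_d9, Real.exp_pos 1]

lemma transitiveWeight_le (ℓ : ℕ) {k : ℕ} (hk : k ≠ 0) :
    transitiveWeight ℓ k ≤ subgroupCount (Fin ℓ → Multiplicative ℤ) k := by
  have := finite_subgroup_lattice ℓ k hk
  rw [transitiveWeight, div_le_iff₀ (by positivity), mul_comm (subgroupCount _ k : ℝ)]
  exact_mod_cast mul_card_transitiveHoms_le (G := Fin ℓ → Multiplicative ℤ) hk

/-! ### Lower bounds by translation actions, and the resulting weights -/

/-- The action of `ℤ^ℓ` on `ℤ/p` by translations. -/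
def translationHom {ℓ p : ℕ} (c : Fin ℓ → ZMod p) :
    (Fin ℓ → Multiplicative ℤ) →* Perm (ZMod p) where
  toFun g := Equiv.addRight (∑ i, ((g i).toAdd : ZMod p) * c i)
  map_one' := by ext; simp
  map_mul' g h := by
    ext x
    simp [add_mul, Finset.sum_add_distrib, add_comm, add_left_comm, add_assoc]

lemma translationHom_mulSingle_apply {ℓ p : ℕ} (c : Fin ℓ → ZMod p) (i : Fin ℓ) (z : ℤ)
    (x : ZMod p) :
    translationHom c (Pi.mulSingle i (Multiplicative.ofAdd z)) x = x + z * c i := by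
  simp only [translationHom, MonoidHom.coe_mk, OneHom.coe_mk, Equiv.coe_addRight]
  rw [Finset.sum_eq_single i]
  · simp
  · intro j _ hj
    simp [Pi.mulSingle_eq_of_ne hj]
  · simp

/-- Each nonzero c in (ℤ/p)^ℓ gives a translation action. It is transitive because a nonzero
coordinate generates ℤ/p, and it determines c by moving 0. -/
lemma pow_le_card_transitiveHoms_add_one (ℓ : ℕ) {p : ℕ} (hp : p.Prime) :
    p ^ ℓ ≤ Nat.card (transitiveHoms (Fin ℓ → Multiplicative ℤ) (Fin p)) + 1 := by
  classical
  have : Fact p.Prime := ⟨hp⟩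
  let F : {c : Fin ℓ → ZMod p // c ≠ 0} → transitiveHoms (Fin ℓ → Multiplicative ℤ) (ZMod p) :=
    fun c => ⟨translationHom c.1, fun x y => by
      obtain ⟨i, hi⟩ := Function.ne_iff.1 c.2
      refine ⟨Pi.mulSingle i (Multiplicative.ofAdd (((y - x) / c.1 i).val : ℤ)), ?_⟩
      rw [translationHom_mulSingle_apply]
      have hi' : c.1 i ≠ 0 := hi
      simp [hi']⟩
  have hF : Function.Injective F := by
    intro c d h
    ext i
    have h1 := congrArg (fun f => f.1 (Pi.mulSingle i (Multiplicative.ofAdd 1)) 0) h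
    simpa [F, translationHom_mulSingle_apply] using h1
  have hfin : Finite ((Fin ℓ → Multiplicative ℤ) →* Perm (ZMod p)) :=
    Finite.of_equiv _ (ZMod.finEquiv p).toEquiv.permCongrHom.monoidHomCongrRightEquiv
  have h := Nat.card_le_card_of_injective F hF
  rw [card_transitiveHoms_congr (ZMod.finEquiv p).symm.toEquiv, Nat.card_eq_fintype_card,
    Fintype.card_subtype_compl] at h
  simp only [Fintype.card_fun, ZMod.card, Fintype.card_fin, Fintype.card_unique] at h
  omega

lemma transitiveWeight_one (ℓ : ℕ) : transitiveWeight ℓ 1 = 1 := by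
  have h := mul_commN_eq_sum ℓ 1
  simpa [Finset.sum_range_succ, commN_one, commN_zero, transitiveWeight_zero] using h.symm

lemma transitiveWeight_two (ℓ : ℕ) : transitiveWeight ℓ 2 = 2 ^ ℓ - 1 := by
  refine le_antisymm ?_ ?_
  · have h := subgroupCount_lattice_prime_le ℓ Nat.prime_two
    have h' : (subgroupCount (Fin ℓ → Multiplicative ℤ) 2 : ℝ) + 1 ≤ 2 ^ ℓ := by
      exact_mod_cast (by simpa using h)
    have := transitiveWeight_le ℓ (k := 2) (by norm_num)
    linarith
  · have h := pow_le_card_transitiveHoms_add_one ℓ Nat.prime_two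
    have h' : (2 : ℝ) ^ ℓ ≤ Nat.card (transitiveHoms (Fin ℓ → Multiplicative ℤ) (Fin 2)) + 1 := by
      exact_mod_cast h
    simp only [transitiveWeight, Nat.factorial]
    push_cast
    linarith

lemma le_transitiveWeight_three (ℓ : ℕ) : ((3 : ℝ) ^ ℓ - 1) / 2 ≤ transitiveWeight ℓ 3 := by
  have h := pow_le_card_transitiveHoms_add_one ℓ Nat.prime_three
  have h' : (3 : ℝ) ^ ℓ ≤ Nat.card (transitiveHoms (Fin ℓ → Multiplicative ℤ) (Fin 3)) + 1 := by
    exact_mod_cast h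
  simp only [transitiveWeight, Nat.factorial]
  push_cast
  linarith

lemma transitiveWeight_three_le (ℓ : ℕ) : transitiveWeight ℓ 3 ≤ 3 ^ ℓ / 2 := by
  have h := (Nat.le_add_right _ _).trans (subgroupCount_lattice_prime_le ℓ Nat.prime_three)
  have h' : (2 : ℝ) * subgroupCount (Fin ℓ → Multiplicative ℤ) 3 ≤ 3 ^ ℓ := by exact_mod_cast h
  have := transitiveWeight_le ℓ (k := 3) (by norm_num)
  linarith

lemma transitiveWeight_four_le (ℓ : ℕ) : transitiveWeight ℓ 4 ≤ 4 ^ ℓ := by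
  have h := (Nat.le_add_right _ _).trans (subgroupCount_lattice_four_le ℓ)
  exact (transitiveWeight_le ℓ (by norm_num)).trans (by exact_mod_cast h)

lemma transitiveWeight_five_le (ℓ : ℕ) : transitiveWeight ℓ 5 ≤ 5 ^ ℓ / 4 := by
  have h := (Nat.le_add_right _ _).trans (subgroupCount_lattice_prime_le ℓ Nat.prime_five)
  have h' : (4 : ℝ) * subgroupCount (Fin ℓ → Multiplicative ℤ) 5 ≤ 5 ^ ℓ := by exact_mod_cast h
  have := transitiveWeight_le ℓ (k := 5) (by norm_num)
  linarith

lemma transitiveWeight_le_pow (ℓ : ℕ) {k : ℕ} (hk : k ≠ 0) :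
    transitiveWeight ℓ k ≤ 8 * (k : ℝ) ^ ℓ :=
  (transitiveWeight_le ℓ hk).trans (subgroupCount_lattice_le ℓ hk)

/-! ### Exponentials of weight sequences and bounds on their coefficients -/

/-- `c` is the coefficient sequence of `exp (∑ k, s k / k * t ^ k)`. -/
def IsExpCoeff (s c : ℕ → ℝ) : Prop :=
  c 0 = 1 ∧ ∀ n : ℕ, n * c n = ∑ k ∈ Finset.range (n + 1), s k * c (n - k)

namespace IsExpCoeff

-- The recursion is the differential equation X C' = S C read coefficientwise; in this form products
-- follow from the Leibniz rule.
open PowerSeries in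
lemma iff_derivative {s c : ℕ → ℝ} : IsExpCoeff s c ↔
    c 0 = 1 ∧ X * PowerSeries.derivative ℝ (PowerSeries.mk c) = PowerSeries.mk s * PowerSeries.mk c := by
  refine and_congr_right fun _ => ?_
  rw [PowerSeries.ext_iff]
  refine forall_congr' fun n => ?_
  have h1 : coeff n (X * PowerSeries.derivative ℝ (PowerSeries.mk c)) = n * c n := by
    cases n with
    | zero => simp
    | succ n => rw [coeff_succ_X_mul, coeff_derivative, coeff_mk, mul_comm]; push_cast; rfl
  rw [h1, coeff_mul, Finset.Nat.sum_antidiagonal_eq_sum_range_succ_mk]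
  simp

lemma mul {s c s' c' : ℕ → ℝ} (h : IsExpCoeff s c) (h' : IsExpCoeff s' c') :
    IsExpCoeff (s + s') fun n => ∑ k ∈ Finset.range (n + 1), c k * c' (n - k) := by
  rw [iff_derivative] at *
  refine ⟨by simp [h.1, h'.1], ?_⟩
  have e1 : PowerSeries.mk (fun n => ∑ k ∈ Finset.range (n + 1), c k * c' (n - k)) =
      PowerSeries.mk c * PowerSeries.mk c' := by
    ext n
    rw [PowerSeries.coeff_mul, Finset.Nat.sum_antidiagonal_eq_sum_range_succ_mk]
    simp
  have e2 : PowerSeries.mk (s + s') = PowerSeries.mk s + PowerSeries.mk s' := by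
    ext n; simp
  rw [e1, e2, Derivation.leibniz, smul_eq_mul, smul_eq_mul, mul_add]
  linear_combination PowerSeries.mk c * h'.2 + PowerSeries.mk c' * h.2

lemma unique {s c c' : ℕ → ℝ} (h0 : s 0 = 0) (h : IsExpCoeff s c) (h' : IsExpCoeff s c') :
    c = c' := by
  funext n
  induction n using Nat.strong_induction_on with
  | _ n ih =>
    rcases Nat.eq_zero_or_pos n with rfl | hn
    · rw [h.1, h'.1]
    · have hn' : (n : ℝ) ≠ 0 := by positivity
      refine mul_left_cancel₀ hn' ?_
      rw [h.2, h'.2]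
      refine Finset.sum_congr rfl fun k _ => ?_
      rcases Nat.eq_zero_or_pos k with rfl | hk
      · rw [h0, zero_mul, zero_mul]
      · rw [ih (n - k) (by omega)]

/-- The coefficients of `exp (u * t ^ 3)`. -/
lemma cube (u : ℝ) : IsExpCoeff (Pi.single 3 (3 * u))
    fun n => if 3 ∣ n then u ^ (n / 3) / (n / 3).factorial else 0 := by
  refine ⟨by simp, fun n => ?_⟩
  rcases lt_or_ge n 3 with hn | hn
  · rw [Finset.sum_eq_zero fun k hk => by
      rw [Pi.single_eq_of_ne (by have := Finset.mem_range.1 hk; omega), zero_mul]]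
    interval_cases n <;> simp
  · rw [Finset.sum_eq_single_of_mem 3 (Finset.mem_range.2 (by omega))
      fun k _ hk => by rw [Pi.single_eq_of_ne hk, zero_mul]]
    obtain ⟨m, rfl⟩ : ∃ m, n = m + 3 := ⟨n - 3, by omega⟩
    rw [Pi.single_eq_same, Nat.add_sub_cancel]
    simp only [Nat.dvd_add_self_right]
    split_ifs with h
    · obtain ⟨j, rfl⟩ := h
      rw [show (3 * j + 3) / 3 = j + 1 by omega, show 3 * j / 3 = j by omega, Nat.factorial_succ]
      push_cast
      field_simp
      ring
    · simp

/-- Every weight sequence has an exponential. -/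
noncomputable def expSeq (s : ℕ → ℝ) : ℕ → ℝ
  | 0 => 1
  | n + 1 => (∑ k : Fin (n + 1), s (k + 1) * expSeq s (n - k)) / (n + 1)
  termination_by n => n

lemma exists_isExpCoeff {s : ℕ → ℝ} (h0 : s 0 = 0) : ∃ c, IsExpCoeff s c := by
  refine ⟨expSeq s, by rw [expSeq], fun n => ?_⟩
  rw [Finset.sum_range_succ', h0, zero_mul, add_zero]
  cases n with
  | zero => simp
  | succ n =>
    rw [expSeq, Fin.sum_univ_eq_sum_range (fun k => s (k + 1) * expSeq s (n - k))]
    push_cast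
    rw [mul_div_cancel₀ _ (by positivity)]

/-- Separating the weight at `3`. -/
theorem eq_sum_cube {s c e : ℕ → ℝ} (h0 : s 0 = 0) (h : IsExpCoeff s c)
    (he : IsExpCoeff (Function.update s 3 0) e) (n : ℕ) :
    c n = ∑ i ∈ Finset.range (n / 3 + 1), (s 3 / 3) ^ i / i.factorial * e (n - 3 * i) := by
  have hs : Pi.single 3 (3 * (s 3 / 3)) + Function.update s 3 0 = s := by
    funext k
    by_cases hk : k = 3
    · subst hk; simp; ring
    · simp [hk]
  have hm := (cube (s 3 / 3)).mul he
  rw [hs] at hm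
  rw [unique h0 h hm]
  simp only [ite_mul, zero_mul]
  rw [← Finset.sum_filter]
  symm
  refine Finset.sum_nbij' (fun i => 3 * i) (fun k => k / 3) ?_ ?_ ?_ ?_ ?_
  · intro i hi
    simp only [Finset.mem_range, Finset.mem_filter] at *
    omega
  · intro i hi
    simp only [Finset.mem_range, Finset.mem_filter] at *
    omega
  · intro i hi
    omega
  · intro i hi
    simp only [Finset.mem_range, Finset.mem_filter] at *
    omega
  · intro i hi
    rw [show 3 * i / 3 = i by omega]

lemma scale {s c : ℕ → ℝ} (q : ℝ) (h : IsExpCoeff s c) :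
    IsExpCoeff (fun k => s k / q ^ k) fun n => c n / q ^ n := by
  refine ⟨by simp [h.1], fun n => ?_⟩
  rw [mul_div_assoc', h.2, Finset.sum_div]
  refine Finset.sum_congr rfl fun k hk => ?_
  rw [div_mul_div_comm, ← pow_add, Nat.add_sub_cancel' (Nat.lt_succ_iff.1 (Finset.mem_range.1 hk))]

section bounds

variable {w x : ℕ → ℝ} {δ : ℝ}

lemma mul_eq_sum_range (h : IsExpCoeff w x) (h0 : w 0 = 0) (n : ℕ) :
    n * x n = ∑ k ∈ Finset.range n, w (k + 1) * x (n - (k + 1)) := by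
  rw [h.2, Finset.sum_range_succ', h0, zero_mul, add_zero]

lemma nonneg (h : IsExpCoeff w x) (h0 : w 0 = 0) (hw : ∀ k, 0 ≤ w k) (n : ℕ) : 0 ≤ x n := by
  induction n using Nat.strong_induction_on with
  | _ n ih =>
    rcases Nat.eq_zero_or_pos n with rfl | hn
    · rw [h.1]; exact zero_le_one
    · have hn' : (0 : ℝ) < n := by positivity
      refine nonneg_of_mul_nonneg_right ?_ hn'
      rw [h.mul_eq_sum_range h0]
      exact Finset.sum_nonneg fun k _ => mul_nonneg (hw _) (ih _ (by omega))

/-- The extreme case has all weights equal to 1: exp(∑ t^k / k) = 1 / (1 - t). -/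
lemma le_one (h : IsExpCoeff w x) (h0 : w 0 = 0) (hw : ∀ k, 0 ≤ w k) (hw1 : ∀ k, w k ≤ 1) (n : ℕ) :
    x n ≤ 1 := by
  induction n using Nat.strong_induction_on with
  | _ n ih =>
    rcases Nat.eq_zero_or_pos n with rfl | hn
    · rw [h.1]
    · have hn' : (0 : ℝ) < n := by positivity
      refine le_of_mul_le_mul_left ?_ hn'
      rw [h.mul_eq_sum_range h0]
      calc _ ≤ ∑ k ∈ Finset.range n, (1 : ℝ) := Finset.sum_le_sum fun k _ =>
            mul_le_one₀ (hw1 _) (h.nonneg h0 hw _) (ih _ (by omega))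
        _ = _ := by simp

/-- An odd n cannot be split into even parts only: in each term of the recursion either k or n - k
is odd and supplies the factor δ. -/
lemma odd_le (h : IsExpCoeff w x) (h0 : w 0 = 0) (hw : ∀ k, 0 ≤ w k) (hw1 : ∀ k, w k ≤ 1)
    (hδ : ∀ k, Odd k → w k ≤ δ) (n : ℕ) (hn : Odd n) : x n ≤ δ := by
  induction n using Nat.strong_induction_on with
  | _ n ih =>
    have hn' : (0 : ℝ) < n := by exact_mod_cast hn.pos
    refine le_of_mul_le_mul_left ?_ hn'
    rw [h.mul_eq_sum_range h0]
    calc _ ≤ ∑ k ∈ Finset.range n, δ := Finset.sum_le_sum fun k hk => ?_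
      _ = _ := by simp
    have hk' : k + 1 ≤ n := Finset.mem_range.1 hk
    rcases Nat.even_or_odd (k + 1) with he | ho
    · exact (mul_le_of_le_one_left (h.nonneg h0 hw _) (hw1 _)).trans
        (ih _ (by omega) (Nat.Odd.sub_even hk' hn he))
    · exact (mul_le_of_le_one_right (hw _) (h.le_one h0 hw hw1 _)).trans (hδ _ ho)

lemma mul_le_add_add (h : IsExpCoeff w x) (h0 : w 0 = 0) (hw : ∀ k, 0 ≤ w k) (hw1 : ∀ k, w k ≤ 1)
    (hδ0 : 0 ≤ δ) (hδ : ∀ k, k ≠ 2 → k ≠ 4 → w k ≤ δ) {n : ℕ} (hn : 4 ≤ n) :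
    n * x n ≤ x (n - 2) + x (n - 4) + δ * n := by
  rw [h.mul_eq_sum_range h0]
  calc ∑ k ∈ Finset.range n, w (k + 1) * x (n - (k + 1))
      ≤ ∑ k ∈ Finset.range n, ((if k = 1 then x (n - 2) else 0) +
          (if k = 3 then x (n - 4) else 0) + δ) := by
        refine Finset.sum_le_sum fun k _ => ?_
        have hx := h.nonneg h0 hw (n - (k + 1))
        have hx1 := mul_le_of_le_one_left hx (hw1 (k + 1))
        by_cases h1 : k = 1
        · subst h1
          simpa using hx1.trans (le_add_of_nonneg_right hδ0)
        · by_cases h3 : k = 3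
          · subst h3
            simpa using hx1.trans (le_add_of_nonneg_right hδ0)
          · simp only [h1, h3, if_false, zero_add]
            exact (mul_le_of_le_one_right (hw _) (h.le_one h0 hw hw1 _)).trans
              (hδ _ (by omega) (by omega))
    _ = _ := by
        rw [Finset.sum_add_distrib, Finset.sum_add_distrib, Finset.sum_ite_eq',
          Finset.sum_ite_eq', if_pos (Finset.mem_range.2 (by omega)),
          if_pos (Finset.mem_range.2 (by omega))]
        simp [mul_comm]

end bounds

end IsExpCoeff

/-! ### Expansions dominated by the cube factor -/

/-- A sequence of the form `exp (u * t ^ 3) * ∑ j, x j * (q * t) ^ j` whose second factor is dominated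
by its even part. The sequences `commN ℓ` have this form for large `ℓ`. -/
structure CubeDominated (N x : ℕ → ℝ) (u q : ℝ) : Prop where
  u_pos : 0 < u
  q_pos : 0 < q
  u_le : u ≤ q ^ 4 / 1000
  eq_sum : ∀ n, N n = ∑ i ∈ Finset.range (n / 3 + 1),
    u ^ i / i.factorial * (x (n - 3 * i) * q ^ (n - 3 * i))
  x_nonneg : ∀ n, 0 ≤ x n
  x_zero : x 0 = 1
  x_one : x 1 * q = 1
  x_two : x 2 = 1 / 2
  le_x_four : 1249 / 10000 ≤ x 4
  x_four_le : x 4 ≤ 38 / 100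
  x_odd_le : ∀ n, Odd n → x n ≤ 1 / 250
  x_le_fifth : ∀ n, 5 ≤ n → x n ≤ 1 / 5
  x_le_twentieth : ∀ n, 9 ≤ n → x n ≤ 1 / 20

/-- From j = 2 on, the terms are at most c K(K-1)ρ^2 times powers of (K-2)ρ ≤ 1/4, a geometric
series with sum at most 4/3. -/
lemma sum_descFactorial_mul_pow_le {K : ℕ} {ρ c : ℝ} {y : ℕ → ℝ} (hρ : 0 ≤ ρ) (hc : 0 ≤ c)
    (hK : ((K : ℝ) - 2) * ρ ≤ 1 / 4) (hyc : ∀ j, 2 ≤ j → y j ≤ c) :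
    ∑ j ∈ Finset.range (K + 1), K.descFactorial j * ρ ^ j * y j ≤
      y 0 + K * ρ * y 1 + 4 / 3 * c * (K * (K - 1) * ρ ^ 2) := by
  match K with
  | 0 => simp
  | 1 => simp [Finset.sum_range_succ]
  | M + 2 =>
    push_cast at hK ⊢
    have hz : (M : ℝ) * ρ ≤ 1 / 4 := by linarith
    have hz0 : 0 ≤ (M : ℝ) * ρ := by positivity
    rw [Finset.sum_range_succ', Finset.sum_range_succ']
    have hgeom : ∑ j ∈ Finset.range (M + 1), ((M : ℝ) * ρ) ^ j ≤ 4 / 3 := by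
      have h := mul_neg_geom_sum ((M : ℝ) * ρ) (M + 1)
      have hp : 0 ≤ ((M : ℝ) * ρ) ^ (M + 1) := by positivity
      have hs : 0 ≤ ∑ j ∈ Finset.range (M + 1), ((M : ℝ) * ρ) ^ j :=
        Finset.sum_nonneg fun j _ => by positivity
      nlinarith
    have htail : ∑ j ∈ Finset.range (M + 1),
        ((M + 2).descFactorial (j + 1 + 1) : ℝ) * ρ ^ (j + 1 + 1) * y (j + 1 + 1) ≤
        ∑ j ∈ Finset.range (M + 1), ((M + 2) * (M + 1) * ρ ^ 2 * c) * ((M : ℝ) * ρ) ^ j := by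
      refine Finset.sum_le_sum fun j _ => ?_
      have hd : ((M + 2).descFactorial (j + 1 + 1) : ℝ) ≤ (M + 2) * (M + 1) * (M : ℝ) ^ j := by
        rw [Nat.succ_descFactorial_succ, Nat.succ_descFactorial_succ]
        have := Nat.descFactorial_le_pow M j
        have h' : (M.descFactorial j : ℝ) ≤ (M : ℝ) ^ j := by exact_mod_cast this
        push_cast
        rw [mul_assoc ((M : ℝ) + 2)]
        have h2 : ((M : ℝ) + 1 + 1) = M + 2 := by ring
        rw [h2]
        gcongr
      calc _ ≤ ((M + 2).descFactorial (j + 1 + 1) : ℝ) * ρ ^ (j + 1 + 1) * c :=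
            mul_le_mul_of_nonneg_left (hyc _ (by omega)) (by positivity)
        _ ≤ ((M + 2) * (M + 1) * (M : ℝ) ^ j) * ρ ^ (j + 1 + 1) * c := by gcongr
        _ = _ := by rw [mul_pow]; ring
    rw [← Finset.mul_sum] at htail
    have hpos : 0 ≤ ((M : ℝ) + 2) * (M + 1) * ρ ^ 2 * c := by positivity
    have := htail.trans (mul_le_mul_of_nonneg_left hgeom hpos)
    simp only [zero_add, Nat.descFactorial_zero, Nat.descFactorial_one, pow_zero, pow_one]
    push_cast
    nlinarith [this]

namespace CubeDominated

variable {N x : ℕ → ℝ} {u q : ℝ}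

lemma nonneg (h : CubeDominated N x u q) (n : ℕ) : 0 ≤ N n := by
  rw [h.eq_sum]
  have := h.u_pos
  have := h.q_pos
  exact Finset.sum_nonneg fun i _ => by have := h.x_nonneg (n - 3 * i); positivity

lemma le_apply (h : CubeDominated N x u q) (K r : ℕ) :
    u ^ K / K.factorial * (x r * q ^ r) ≤ N (3 * K + r) := by
  have := h.u_pos
  have := h.q_pos
  rw [h.eq_sum]
  refine le_trans (le_of_eq ?_) (Finset.single_le_sum (f := fun i : ℕ => u ^ i / i.factorial *
    (x (3 * K + r - 3 * i) * q ^ (3 * K + r - 3 * i)))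
    (fun i _ => by have := h.x_nonneg (3 * K + r - 3 * i); positivity)
    (Finset.mem_range.2 (by omega : K < (3 * K + r) / 3 + 1)))
  rw [Nat.add_sub_cancel_left]

/-- Reversing the sum by i = K - j pulls out the leading term u^K / K! · q^r and leaves descending
factorials of K times powers of q^3 / u. -/
lemma sum_range_le (h : CubeDominated N x u q) (K r : ℕ) {c : ℝ} (hc : 0 ≤ c)
    (hK : ((K : ℝ) - 2) * (q ^ 3 / u) ≤ 1 / 4) (hxc : ∀ n, r + 6 ≤ n → x n ≤ c) :
    ∑ i ∈ Finset.range (K + 1), u ^ i / i.factorial *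
      (x (3 * K + r - 3 * i) * q ^ (3 * K + r - 3 * i)) ≤
    u ^ K / K.factorial * q ^ r * (x r + K * (q ^ 3 / u) * x (r + 3) +
      4 / 3 * c * (K * (K - 1) * (q ^ 3 / u) ^ 2)) := by
  have hu := h.u_pos
  have hq := h.q_pos
  have key := sum_descFactorial_mul_pow_le (K := K) (ρ := q ^ 3 / u) (c := c)
    (y := fun j => x (r + 3 * j)) (by positivity) hc hK
    (fun j hj => hxc _ (by omega))
  refine le_trans (le_of_eq ?_) (mul_le_mul_of_nonneg_left key
    (by positivity : 0 ≤ u ^ K / K.factorial * q ^ r))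
  rw [← Finset.sum_range_reflect, Finset.mul_sum]
  refine Finset.sum_congr rfl fun j hj => ?_
  have hj' : j ≤ K := Nat.lt_succ_iff.1 (Finset.mem_range.1 hj)
  obtain ⟨i, rfl⟩ := Nat.exists_eq_add_of_le hj'
  rw [show j + i + 1 - 1 - j = i by omega, show 3 * (j + i) + r - 3 * i = r + 3 * j by omega]
  have hf : ((j + i).factorial : ℝ) = i.factorial * (j + i).descFactorial j := by
    have := Nat.factorial_mul_descFactorial (n := j + i) (k := j) (by omega)
    rw [Nat.add_sub_cancel_left] at this
    exact_mod_cast this.symm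
  have hd : ((j + i).descFactorial j : ℝ) ≠ 0 := by
    have : (j + i).descFactorial j ≠ 0 := fun h0 => by
      rw [Nat.descFactorial_eq_zero_iff_lt] at h0; omega
    exact_mod_cast this
  rw [hf, div_pow, pow_add u]
  field_simp
  ring

lemma apply_le (h : CubeDominated N x u q) (K : ℕ) {r : ℕ} (hr : r < 3)
    (hK : ((K : ℝ) - 2) * (q ^ 3 / u) ≤ 1 / 4) :
    N (3 * K + r) ≤ u ^ K / K.factorial * q ^ r * (x r + K * (q ^ 3 / u) * x (r + 3) +
      4 / 15 * (K * (K - 1) * (q ^ 3 / u) ^ 2)) := by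
  have h1 := h.sum_range_le K r (c := 1 / 5) (by norm_num) hK
    (fun n hn => h.x_le_fifth n (by omega))
  rw [h.eq_sum, show (3 * K + r) / 3 = K by omega]
  refine h1.trans (le_of_eq ?_)
  norm_num

/-- Compared with `sum_range_le` there is one more summand, i = K + 1 with a single point left over.
There x_1 q = 1, and u ≤ q^4 / 1000 makes it negligible. -/
lemma apply_add_four_le (h : CubeDominated N x u q) (K : ℕ)
    (hK : ((K : ℝ) - 2) * (q ^ 3 / u) ≤ 1 / 4) :
    N (3 * K + 4) ≤ u ^ K / K.factorial * q ^ 4 * (x 4 + 1 / 1000 + K * (q ^ 3 / u) * (1 / 250) +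
      1 / 15 * (K * (K - 1) * (q ^ 3 / u) ^ 2)) := by
  have hu := h.u_pos
  have hq := h.q_pos
  have h1 := h.sum_range_le K 4 (c := 1 / 20) (by norm_num) hK
    (fun n hn => h.x_le_twentieth n (by omega))
  rw [h.eq_sum, show (3 * K + 4) / 3 = K + 1 by omega, Finset.sum_range_succ,
    show 3 * K + 4 - 3 * (K + 1) = 1 by omega, pow_one, h.x_one]
  have h2 : u ^ (K + 1) / (K + 1).factorial * 1 ≤ u ^ K / K.factorial * q ^ 4 * (1 / 1000) := by
    have h3 : u ^ (K + 1) / (K + 1).factorial ≤ u ^ (K + 1) / K.factorial := by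
      gcongr
      omega
    calc _ ≤ u ^ K / K.factorial * u := by rw [mul_one]; refine h3.trans (le_of_eq ?_); ring
      _ ≤ u ^ K / K.factorial * (q ^ 4 / 1000) := by gcongr; exact h.u_le
      _ = _ := by ring
  have h7 : K * (q ^ 3 / u) * x (4 + 3) ≤ K * (q ^ 3 / u) * (1 / 250) := by
    gcongr
    exact h.x_odd_le _ (by decide)
  refine (add_le_add h1 h2).trans ?_
  rw [← mul_add]
  exact mul_le_mul_of_nonneg_left (by linarith) (by positivity)

end CubeDominated

/-! ### The sequence N_ℓ on the scale √2^ℓ, for ℓ ≥ 36 -/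

lemma le_mul_sqrt_two_pow {β : ℝ} (hβ : 0 ≤ β) {k : ℕ} (h : (k : ℝ) ^ 2 ≤ β ^ 2 * 2 ^ k) :
    (k : ℝ) ≤ β * √2 ^ k := by
  refine le_of_sq_le_sq ?_ (by positivity)
  rwa [mul_pow, ← pow_mul, mul_comm k 2, pow_mul, Real.sq_sqrt (by norm_num)]

lemma pow_div_pow_le {β : ℝ} (hβ : 0 ≤ β) (hβ1 : β ≤ 1) {k : ℕ} (h : (k : ℝ) ^ 2 ≤ β ^ 2 * 2 ^ k)
    {ℓ : ℕ} (hℓ : 36 ≤ ℓ) : (k : ℝ) ^ ℓ / (√2 ^ ℓ) ^ k ≤ β ^ 36 := by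
  rw [← pow_mul, mul_comm ℓ k, pow_mul, ← div_pow]
  have h1 : (k : ℝ) / √2 ^ k ≤ β := (div_le_iff₀ (by positivity)).2 (le_mul_sqrt_two_pow hβ h)
  calc ((k : ℝ) / √2 ^ k) ^ ℓ ≤ β ^ ℓ := by gcongr
    _ ≤ β ^ 36 := pow_le_pow_of_le_one hβ hβ1 hℓ

lemma sixteen_mul_sq_le {k : ℕ} (hk : 6 ≤ k) : 16 * k ^ 2 ≤ 9 * 2 ^ k := by
  induction k, hk using Nat.le_induction with
  | base => norm_num
  | succ k hk ih => rw [pow_succ 2 k]; nlinarith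

/-- The weights of `commN ℓ` other than that of `3`, in the scale `√2 ^ ℓ`. -/
noncomputable def scaledWeight (ℓ k : ℕ) : ℝ :=
  Function.update (transitiveWeight ℓ) 3 0 k / (√2 ^ ℓ) ^ k

section scaledWeight

variable {ℓ : ℕ}

lemma scaledWeight_zero : scaledWeight ℓ 0 = 0 := by simp [scaledWeight, transitiveWeight_zero]

lemma scaledWeight_of_ne {k : ℕ} (hk : k ≠ 3) :
    scaledWeight ℓ k = transitiveWeight ℓ k / (√2 ^ ℓ) ^ k := by
  rw [scaledWeight, Function.update_of_ne hk]

lemma scaledWeight_nonneg (k : ℕ) : 0 ≤ scaledWeight ℓ k := by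
  by_cases hk : k = 3
  · simp [scaledWeight, hk]
  · rw [scaledWeight_of_ne hk]
    have := transitiveWeight_nonneg ℓ k
    positivity

lemma sqrt_two_pow_sq : (√2 ^ ℓ) ^ 2 = 2 ^ ℓ := by
  rw [← pow_mul, mul_comm, pow_mul, Real.sq_sqrt (by norm_num)]

lemma sqrt_two_pow_four : (√2 ^ ℓ) ^ 4 = 4 ^ ℓ := by
  rw [show (√2 ^ ℓ) ^ 4 = (√2 ^ ℓ) ^ (2 * 2) from rfl, pow_mul _ 2 2, sqrt_two_pow_sq, ← pow_mul, mul_comm, pow_mul]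
  norm_num

lemma sqrt_two_pow_six : (√2 ^ ℓ) ^ 6 = 8 ^ ℓ := by
  rw [show (√2 ^ ℓ) ^ 6 = (√2 ^ ℓ) ^ (2 * 3) from rfl, pow_mul _ 2 3, sqrt_two_pow_sq, ← pow_mul, mul_comm, pow_mul]
  norm_num

lemma scaledWeight_two : scaledWeight ℓ 2 = 1 - 1 / 2 ^ ℓ := by
  rw [scaledWeight_of_ne (by norm_num), transitiveWeight_two, sqrt_two_pow_sq, sub_div,
    div_self (by positivity)]

lemma scaledWeight_one : scaledWeight ℓ 1 = 1 / √2 ^ ℓ := by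
  rw [scaledWeight_of_ne (by norm_num), transitiveWeight_one, pow_one]

lemma scaledWeight_four_le : scaledWeight ℓ 4 ≤ 1 := by
  rw [scaledWeight_of_ne (by norm_num), sqrt_two_pow_four]
  exact div_le_one_of_le₀ (transitiveWeight_four_le ℓ) (by positivity)

/-- The critical index is 5, where 5 / √2^5 is about 0.884; the sharp constant 1/4 for subgroups of
index 5 is needed there. For k ≥ 6 the ratio k / √2^k is at most 3/4, its value at 6, and the crude
constant 8 is harmless. -/
lemma scaledWeight_le (hℓ : 36 ≤ ℓ) {k : ℕ} (h2 : k ≠ 2) (h4 : k ≠ 4) :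
    scaledWeight ℓ k ≤ 1 / 250 := by
  by_cases h3 : k = 3
  · simp [scaledWeight, h3]
  rcases Nat.eq_zero_or_pos k with rfl | h0
  · rw [scaledWeight_zero]; norm_num
  rw [scaledWeight_of_ne h3]
  by_cases h1 : k = 1
  · subst h1
    have := pow_div_pow_le (β := 3 / 4) (k := 1) (by norm_num) (by norm_num) (by norm_num) hℓ
    rw [transitiveWeight_one]
    refine le_trans (by simpa using this) (by norm_num)
  by_cases h5 : k = 5
  · subst h5
    have := pow_div_pow_le (β := 885 / 1000) (k := 5) (by norm_num) (by norm_num) (by norm_num) hℓ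
    calc _ ≤ (5 : ℝ) ^ ℓ / 4 / (√2 ^ ℓ) ^ 5 := by
          gcongr
          exact transitiveWeight_five_le ℓ
      _ = ((5 : ℕ) : ℝ) ^ ℓ / (√2 ^ ℓ) ^ 5 / 4 := by push_cast; ring
      _ ≤ (885 / 1000) ^ 36 / 4 := by gcongr
      _ ≤ _ := by norm_num
  · have hk : (k : ℝ) ^ 2 ≤ (3 / 4) ^ 2 * 2 ^ k := by
      have : (16 : ℝ) * k ^ 2 ≤ 9 * 2 ^ k := by
        exact_mod_cast sixteen_mul_sq_le (k := k) (by omega)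
      linarith
    have := pow_div_pow_le (β := 3 / 4) (k := k) (by norm_num) (by norm_num) hk hℓ
    calc _ ≤ 8 * (k : ℝ) ^ ℓ / (√2 ^ ℓ) ^ k := by
          gcongr
          exact transitiveWeight_le_pow ℓ h0.ne'
      _ = 8 * ((k : ℝ) ^ ℓ / (√2 ^ ℓ) ^ k) := by ring
      _ ≤ 8 * (3 / 4) ^ 36 := by gcongr
      _ ≤ _ := by norm_num

lemma scaledWeight_le_one (hℓ : 36 ≤ ℓ) (k : ℕ) : scaledWeight ℓ k ≤ 1 := by
  by_cases h2 : k = 2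
  · rw [h2, scaledWeight_two]
    have : (0 : ℝ) ≤ 1 / 2 ^ ℓ := by positivity
    linarith
  by_cases h4 : k = 4
  · rw [h4]; exact scaledWeight_four_le
  · exact (scaledWeight_le hℓ h2 h4).trans (by norm_num)

end scaledWeight

/-- The coefficient `w 3 / 3` of `t ^ 3` in the logarithm of the generating function of `commN ℓ`. -/
noncomputable def cubeWeight (ℓ : ℕ) : ℝ := transitiveWeight ℓ 3 / 3

lemma pow_ge_of_le {b : ℝ} (hb : 1 ≤ b) {ℓ : ℕ} (hℓ : 36 ≤ ℓ) : b ^ 36 ≤ b ^ ℓ :=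
  pow_le_pow_right₀ hb hℓ

lemma le_cubeWeight {ℓ : ℕ} (hℓ : 36 ≤ ℓ) : (999 / 6000 : ℝ) * 3 ^ ℓ ≤ cubeWeight ℓ := by
  have h := le_transitiveWeight_three ℓ
  have h3 := pow_ge_of_le (b := 3) (by norm_num) hℓ
  norm_num at h3
  rw [cubeWeight]
  linarith

/-- The ratio of the scale `(√2 ^ ℓ) ^ 3` to the weight of `3` is small. -/
lemma ratio_sq_le {ℓ : ℕ} (hℓ : 36 ≤ ℓ) :
    ((√2 ^ ℓ) ^ 3 / cubeWeight ℓ) ^ 2 ≤ 37 * (8 / 9) ^ ℓ := by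
  have h := le_cubeWeight hℓ
  have h0 : (0 : ℝ) < 999 / 6000 * 3 ^ ℓ := by positivity
  rw [div_pow, ← pow_mul, sqrt_two_pow_six, div_pow 8 9]
  have h9 : (9 : ℝ) ^ ℓ = 3 ^ ℓ * 3 ^ ℓ := by rw [← mul_pow]; norm_num
  -- The weight is about 3^ℓ / 6, which would give 36; 37 leaves room for the factor 999/1000.
  have h1 : (9 : ℝ) ^ ℓ / 37 ≤ cubeWeight ℓ ^ 2 := by
    rw [h9]
    nlinarith [mul_le_mul h h h0.le (h0.le.trans h), pow_pos (show (0 : ℝ) < 3 by norm_num) ℓ,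
      mul_pos (pow_pos (show (0 : ℝ) < 3 by norm_num) ℓ) (pow_pos (show (0 : ℝ) < 3 by norm_num) ℓ)]
  calc (8 : ℝ) ^ ℓ / cubeWeight ℓ ^ 2 ≤ 8 ^ ℓ / (9 ^ ℓ / 37) := by gcongr
    _ = _ := by field_simp

theorem exists_cubeDominated {ℓ : ℕ} (hℓ : 36 ≤ ℓ) :
    ∃ x, CubeDominated (commN ℓ) x (cubeWeight ℓ) (√2 ^ ℓ) := by
  have hq : (0 : ℝ) < √2 ^ ℓ := by positivity
  have hN : IsExpCoeff (transitiveWeight ℓ) (commN ℓ) := ⟨commN_zero ℓ, mul_commN_eq_sum ℓ⟩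
  obtain ⟨e, he⟩ := IsExpCoeff.exists_isExpCoeff
    (s := Function.update (transitiveWeight ℓ) 3 0) (by simp [transitiveWeight_zero])
  have hx := he.scale (√2 ^ ℓ)
  change IsExpCoeff (scaledWeight ℓ) _ at hx
  set x : ℕ → ℝ := fun n => e n / (√2 ^ ℓ) ^ n with hxdef
  have w0 : scaledWeight ℓ 0 = 0 := scaledWeight_zero
  have wn := scaledWeight_nonneg (ℓ := ℓ)
  have w1 := scaledWeight_le_one hℓ
  have wδ : ∀ k, k ≠ 2 → k ≠ 4 → scaledWeight ℓ k ≤ 1 / 250 := fun k => scaledWeight_le hℓ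
  have xn := hx.nonneg w0 wn
  have x0 : x 0 = 1 := hx.1
  have xodd : ∀ n, Odd n → x n ≤ 1 / 250 := hx.odd_le w0 wn w1 fun k hk =>
    wδ k (by rintro rfl; exact absurd hk (by decide)) (by rintro rfl; exact absurd hk (by decide))
  have xrec : ∀ n, 4 ≤ n → n * x n ≤ x (n - 2) + x (n - 4) + 1 / 250 * n :=
    fun n => hx.mul_le_add_add w0 wn w1 (by norm_num) wδ
  have x1 : x 1 = 1 / √2 ^ ℓ := by
    have := hx.mul_eq_sum_range w0 1
    simpa [Finset.sum_range_succ, x0, scaledWeight_one] using this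
  have x2 : x 2 = 1 / 2 := by
    have := hx.mul_eq_sum_range w0 2
    simp only [Finset.sum_range_succ, Finset.sum_range_zero, zero_add, Nat.reduceAdd, Nat.reduceSub,
      x0, x1, scaledWeight_one, scaledWeight_two, ← sq] at this
    push_cast at this
    -- The term w_1 x_1 = 1 / 2^ℓ exactly cancels the deficit of w_2 = 1 - 1 / 2^ℓ.
    rw [div_pow, sqrt_two_pow_sq, one_pow] at this
    linarith
  have x4 : 1249 / 10000 ≤ x 4 := by
    have := hx.mul_eq_sum_range w0 4
    have h1 : scaledWeight ℓ (1 + 1) * x (4 - (1 + 1)) ≤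
        ∑ k ∈ Finset.range 4, scaledWeight ℓ (k + 1) * x (4 - (k + 1)) :=
      Finset.single_le_sum (f := fun k => scaledWeight ℓ (k + 1) * x (4 - (k + 1)))
        (fun k _ => mul_nonneg (wn _) (xn _)) (by simp)
    rw [← this] at h1
    change scaledWeight ℓ 2 * x 2 ≤ _ at h1
    rw [scaledWeight_two, x2] at h1
    have h2 := pow_ge_of_le (b := 2) (by norm_num) hℓ
    have h3 : (1 : ℝ) / 2 ^ ℓ ≤ 1 / 2 ^ 36 := by gcongr
    norm_num at h1 h3 ⊢
    linarith
  have x4' : x 4 ≤ 38 / 100 := by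
    have := xrec 4 le_rfl
    norm_num [x0, x2] at this
    linarith
  -- The bounds 1, 1/2, 1/5, 1/20 are bootstrapped: each is fed into `xrec` at n - 2 and n - 4 to
  -- obtain the next one.
  have xhalf : ∀ n, 1 ≤ n → x n ≤ 1 / 2 := by
    intro n hn
    rcases Nat.even_or_odd n with hev | hod
    · obtain rfl | rfl | h6 : n = 2 ∨ n = 4 ∨ 6 ≤ n := by
        obtain ⟨m, rfl⟩ := hev; omega
      · rw [x2]
      · linarith
      · have h := xrec n (by omega)
        have h1 := hx.le_one w0 wn w1 (n - 2)
        have h2 := hx.le_one w0 wn w1 (n - 4)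
        have hn6 : (6 : ℝ) ≤ n := by exact_mod_cast h6
        by_contra! hc
        change x (n - 2) ≤ 1 at h1
        change x (n - 4) ≤ 1 at h2
        nlinarith
    · linarith [xodd n hod]
  have xfifth : ∀ n, 5 ≤ n → x n ≤ 1 / 5 := by
    intro n hn
    rcases Nat.even_or_odd n with hev | hod
    · have h6 : 6 ≤ n := by obtain ⟨m, rfl⟩ := hev; omega
      have h := xrec n (by omega)
      have h1 := xhalf (n - 2) (by omega)
      have h2 := xhalf (n - 4) (by omega)
      have hn6 : (6 : ℝ) ≤ n := by exact_mod_cast h6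
      by_contra! hc
      nlinarith
    · linarith [xodd n hod]
  refine ⟨x, ?_, hq, ?_, ?_, xn, x0, ?_, x2, x4, x4', xodd, xfifth, ?_⟩
  · exact lt_of_lt_of_le (by positivity) (le_cubeWeight hℓ)
  · rw [sqrt_two_pow_four, cubeWeight]
    have h := transitiveWeight_three_le ℓ
    have h1 := pow_ge_of_le (b := 4 / 3) (by norm_num) hℓ
    have h2 : (1000 : ℝ) ≤ (4 / 3) ^ ℓ := le_trans (by norm_num) h1
    rw [div_pow, le_div_iff₀ (by positivity)] at h2
    have h3 : (0 : ℝ) < 3 ^ ℓ := by positivity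
    linarith
  · intro n
    rw [hN.eq_sum_cube (transitiveWeight_zero ℓ) he n]
    refine Finset.sum_congr rfl fun i _ => ?_
    rw [hxdef, cubeWeight]
    simp only
    rw [div_mul_cancel₀ _ (by positivity)]
  · rw [x1, one_div_mul_cancel hq.ne']
  · intro n hn
    have h := xrec n (by omega)
    have h1 := xfifth (n - 2) (by omega)
    have h2 := xfifth (n - 4) (by omega)
    have hn9 : (9 : ℝ) ≤ n := by exact_mod_cast hn
    by_contra! hc
    nlinarith

/-! ### Comparing N(a) N(b) with N(a + b) -/

/-- A binomial coefficient away from the ends is at least 2. This factor 2 decides all the cases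
with positive sign. -/
lemma two_mul_factorial_mul_factorial_le {i j : ℕ} (hi : 1 ≤ i) (hj : 1 ≤ j) :
    2 * ((i.factorial : ℝ) * j.factorial) ≤ (i + j).factorial := by
  have h := Nat.add_choose_mul_factorial_mul_factorial i j
  have hc : 2 ≤ (i + j).choose j := by
    rw [← Nat.choose_symm_add]
    obtain ⟨i, rfl⟩ : ∃ k, i = k + 1 := ⟨i - 1, by omega⟩
    rw [show i + 1 + j = (i + j) + 1 by omega, Nat.choose_succ_succ]
    have h1 : 0 < (i + j).choose i := Nat.choose_pos (by omega)
    have h2 : 0 < (i + j).choose (i + 1) := Nat.choose_pos (by omega)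
    simp only [Nat.succ_eq_add_one]
    omega
  have : 2 * (i.factorial * j.factorial) ≤ (i + j).factorial := by
    rw [← h, mul_assoc]
    exact Nat.mul_le_mul_right _ hc
  exact_mod_cast this

lemma factorial_le_two_pow_mul (i j : ℕ) :
    ((i + j).factorial : ℝ) ≤ 2 ^ (i + j) * (i.factorial * j.factorial) := by
  have h := Nat.add_choose_mul_factorial_mul_factorial i j
  have : (i + j).factorial ≤ 2 ^ (i + j) * (i.factorial * j.factorial) := by
    rw [← h, mul_assoc]
    exact Nat.mul_le_mul_right _ (Nat.choose_le_two_pow _ _)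
  exact_mod_cast this

lemma add_one_le_two_pow (k : ℕ) : (k : ℝ) + 1 ≤ 2 ^ k := by
  exact_mod_cast (Nat.lt_two_pow_self : k < 2 ^ k)

/-- Here 148 = 4 · 37, so that ρ^2 · 24^(n+1) ≤ 37 forces nρ ≤ 1/2. -/
lemma mul_sq_le_pow (n : ℕ) : (148 : ℝ) * n ^ 2 ≤ 24 ^ (n + 1) := by
  induction n with
  | zero => norm_num
  | succ n ih =>
    rcases Nat.eq_zero_or_pos n with rfl | hn
    · norm_num
    · have : (1 : ℝ) ≤ n := by exact_mod_cast hn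
      rw [pow_succ _ (n + 1)]
      push_cast
      nlinarith

namespace CubeDominated

variable {N x : ℕ → ℝ} {u q : ℝ}

lemma ratio_bounds (h : CubeDominated N x u q) {K : ℕ} (hK : 2 ≤ K)
    (hρ : K * (K - 1) * (q ^ 3 / u) ≤ 36 / 25) :
    ((K : ℝ) - 2) * (q ^ 3 / u) ≤ 1 / 4 ∧ K * (q ^ 3 / u) ≤ 36 / 25 ∧
      K * (K - 1) * (q ^ 3 / u) ^ 2 ≤ 104 / 100 := by
  have hu := h.u_pos
  have hq := h.q_pos
  have h0 : 0 < q ^ 3 / u := by positivity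
  set ρ := q ^ 3 / u
  obtain ⟨m, rfl⟩ := Nat.exists_eq_add_of_le hK
  have hm : (0 : ℝ) ≤ m := m.cast_nonneg
  push_cast at hρ ⊢
  -- This is (m - 1)(m - 2) ≥ 0, valid for integers. It gives K(K-1) ≥ 6(K-2), hence (K-2)ρ ≤ 6/25.
  have hm2 : 3 * (m : ℝ) ≤ m ^ 2 + 2 := by
    have : 3 * m ≤ m ^ 2 + 2 := by
      rcases Nat.lt_or_ge m 3 with h3 | h3
      · interval_cases m <;> norm_num
      · nlinarith
    exact_mod_cast this
  have hmρ : 0 ≤ m * ρ := by positivity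
  refine ⟨?_, ?_, ?_⟩
  · nlinarith
  · nlinarith
  · have h1 : ρ ≤ 72 / 100 := by nlinarith
    nlinarith

lemma apply_three_mul_lt (h : CubeDominated N x u q) {K : ℕ} (hK : 2 ≤ K)
    (hρ : K * (K - 1) * (q ^ 3 / u) ≤ 36 / 25) :
    N (3 * K) < u ^ K / K.factorial * 2 := by
  obtain ⟨h1, h2, h3⟩ := h.ratio_bounds hK hρ
  have hu := h.u_pos
  have hq := h.q_pos
  have h4 : K * (q ^ 3 / u) * x (0 + 3) ≤ 36 / 25 * (1 / 250) :=
    mul_le_mul h2 (h.x_odd_le _ (by decide)) (h.x_nonneg _) (by norm_num)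
  refine (h.apply_le K (r := 0) (by norm_num) h1).trans_lt ?_
  rw [pow_zero, mul_one, h.x_zero]
  exact mul_lt_mul_of_pos_left (by linarith) (by positivity)

lemma apply_three_mul_add_two_lt (h : CubeDominated N x u q) {K : ℕ} (hK : 2 ≤ K)
    (hρ : K * (K - 1) * (q ^ 3 / u) ≤ 36 / 25) :
    N (3 * K + 2) < u ^ K / K.factorial * q ^ 2 := by
  obtain ⟨h1, h2, h3⟩ := h.ratio_bounds hK hρ
  have hu := h.u_pos
  have hq := h.q_pos
  have h4 : K * (q ^ 3 / u) * x (2 + 3) ≤ 36 / 25 * (1 / 250) :=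
    mul_le_mul h2 (h.x_odd_le _ (by decide)) (h.x_nonneg _) (by norm_num)
  refine (h.apply_le K (r := 2) (by norm_num) h1).trans_lt ?_
  rw [h.x_two]
  exact mul_lt_of_lt_one_right (by positivity) (by linarith)

lemma apply_three_mul_add_four_lt (h : CubeDominated N x u q) {K : ℕ} (hK : 2 ≤ K)
    (hρ : K * (K - 1) * (q ^ 3 / u) ≤ 36 / 25) {c : ℝ} (hc : x 4 + 77 / 1000 ≤ c) :
    N (3 * K + 4) < u ^ K / K.factorial * q ^ 4 * c := by
  obtain ⟨h1, h2, h3⟩ := h.ratio_bounds hK hρ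
  have hu := h.u_pos
  have hq := h.q_pos
  refine (h.apply_add_four_le K h1).trans_lt ?_
  exact mul_lt_mul_of_pos_left (by linarith) (by positivity)

lemma le_apply_mul_apply (h : CubeDominated N x u q) {i j : ℕ} (hi : 1 ≤ i) (hj : 1 ≤ j)
    (r s : ℕ) : u ^ (i + j) / (i + j).factorial * (2 * (x r * q ^ r) * (x s * q ^ s)) ≤
      N (3 * i + r) * N (3 * j + s) := by
  have hu := h.u_pos
  have hq := h.q_pos
  have hr := h.x_nonneg r
  have hs := h.x_nonneg s
  refine le_trans ?_ (mul_le_mul (h.le_apply i r) (h.le_apply j s) (by positivity) (h.nonneg _))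
  have hf : (2 : ℝ) / (i + j).factorial ≤ 1 / (i.factorial * j.factorial) := by
    rw [div_le_div_iff₀ (by positivity) (by positivity)]
    linarith [two_mul_factorial_mul_factorial_le hi hj]
  calc _ = (u ^ i * u ^ j * (x r * q ^ r) * (x s * q ^ s)) * (2 / (i + j).factorial) := by
        rw [pow_add]; ring
    _ ≤ (u ^ i * u ^ j * (x r * q ^ r) * (x s * q ^ s)) * (1 / (i.factorial * j.factorial)) := by
        gcongr
    _ = _ := by field_simp

section positive

variable {i j : ℕ}

theorem apply_add_lt_zero_zero (h : CubeDominated N x u q) (hi : 1 ≤ i) (hj : 1 ≤ j)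
    (hρ : (i + j : ℕ) * ((i + j : ℕ) - 1) * (q ^ 3 / u) ≤ 36 / 25) :
    N (3 * (i + j)) < N (3 * i) * N (3 * j) := by
  refine (h.apply_three_mul_lt (by omega) hρ).trans_le ?_
  simpa [h.x_zero] using h.le_apply_mul_apply hi hj 0 0

theorem apply_add_lt_zero_four (h : CubeDominated N x u q) (hi : 1 ≤ i) (hj : 1 ≤ j)
    (hρ : (i + j : ℕ) * ((i + j : ℕ) - 1) * (q ^ 3 / u) ≤ 36 / 25) :
    N (3 * (i + j) + 4) < N (3 * i) * N (3 * j + 4) := by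
  refine (h.apply_three_mul_add_four_lt (by omega) hρ (c := 2 * x 4)
    (by linarith [h.le_x_four])).trans_le ?_
  refine le_trans (le_of_eq ?_) (h.le_apply_mul_apply hi hj 0 4)
  rw [h.x_zero]
  ring

theorem apply_add_lt_zero_two (h : CubeDominated N x u q) (hi : 1 ≤ i) (hj : 1 ≤ j)
    (hρ : (i + j : ℕ) * ((i + j : ℕ) - 1) * (q ^ 3 / u) ≤ 36 / 25) :
    N (3 * (i + j) + 2) < N (3 * i) * N (3 * j + 2) := by
  refine (h.apply_three_mul_add_two_lt (by omega) hρ).trans_le ?_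
  refine le_trans (le_of_eq ?_) (h.le_apply_mul_apply hi hj 0 2)
  rw [h.x_zero, h.x_two]
  ring

/-- The product has coefficient 2 · (1/2)^2 = 1/2 at q^4, while the sum has x_4 plus a small error,
below 0.38 + 0.077. -/
theorem apply_add_lt_two_two (h : CubeDominated N x u q) (hi : 1 ≤ i) (hj : 1 ≤ j)
    (hρ : (i + j : ℕ) * ((i + j : ℕ) - 1) * (q ^ 3 / u) ≤ 36 / 25) :
    N (3 * (i + j) + 4) < N (3 * i + 2) * N (3 * j + 2) := by
  refine (h.apply_three_mul_add_four_lt (by omega) hρ (c := 1 / 2)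
    (by linarith [h.x_four_le])).trans_le ?_
  refine le_trans (le_of_eq ?_) (h.le_apply_mul_apply hi hj 2 2)
  rw [h.x_two]
  ring

end positive

/-- One 3 is given up for a 4, and u^(m-1) / (m-1)! equals m / u times u^m / m!. Writing m + 1
instead of m also covers m = 0, where N(1) = 1. -/
lemma apply_three_mul_add_one_le (h : CubeDominated N x u q) (m : ℕ)
    (hm : ((m : ℝ) - 1) * (q ^ 3 / u) ≤ 1 / 4) :
    N (3 * m + 1) ≤ u ^ m / m.factorial * (q ^ 4 / u) * ((m + 1) / 2) := by
  have hu := h.u_pos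
  have hq := h.q_pos
  have h0 : 0 < q ^ 3 / u := by positivity
  cases m with
  | zero =>
    have h1 := h.u_le
    have h2 : (1000 : ℝ) ≤ q ^ 4 / u := by rw [le_div_iff₀ hu]; linarith
    rw [h.eq_sum]
    simp [h.x_one]
    linarith
  | succ k =>
    push_cast at hm ⊢
    set ρ := q ^ 3 / u with hρ
    have hk : (0 : ℝ) ≤ k := k.cast_nonneg
    have hkρ : k * ρ ≤ 1 / 4 := by linarith
    have hkρ0 : 0 ≤ k * ρ := by positivity
    have h1 := h.apply_add_four_le k (by nlinarith)
    rw [← hρ] at h1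
    have h2 : k * (k - 1) * ρ ^ 2 ≤ 1 / 16 := by nlinarith [mul_nonneg hk (sq_nonneg ρ)]
    rw [show 3 * (k + 1) + 1 = 3 * k + 4 by ring]
    calc _ ≤ _ := h1
      _ ≤ u ^ k / k.factorial * q ^ 4 * (1 / 2) := by
          refine mul_le_mul_of_nonneg_left ?_ (by positivity)
          linarith [h.x_four_le]
      _ = u ^ (k + 1) / (k + 1).factorial * (q ^ 4 / u) * ((k + 1) / 2) := by
          rw [Nat.factorial_succ]
          push_cast
          field_simp
          ring
      _ ≤ _ := by
          refine mul_le_mul_of_nonneg_left ?_ (by positivity)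
          linarith

lemma apply_three_mul_add_two_le (h : CubeDominated N x u q) (m : ℕ)
    (hm : ((m : ℝ) - 2) * (q ^ 3 / u) ≤ 1 / 4) (hm' : m * (q ^ 3 / u) ≤ 1) :
    N (3 * m + 2) ≤ u ^ m / m.factorial * q ^ 2 := by
  have hu := h.u_pos
  have hq := h.q_pos
  have h0 : 0 < q ^ 3 / u := by positivity
  have h4 : m * (q ^ 3 / u) * x (2 + 3) ≤ 1 * (1 / 250) :=
    mul_le_mul hm' (h.x_odd_le _ (by decide)) (h.x_nonneg _) (by norm_num)
  have h1 := h.apply_le m (r := 2) (by norm_num) hm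
  refine h1.trans (mul_le_of_le_one_right (by positivity) ?_)
  rw [h.x_two]
  have hk : (0 : ℝ) ≤ m := m.cast_nonneg
  have h2 : m * (m - 1) * (q ^ 3 / u) ^ 2 ≤ 1 := by
    nlinarith [mul_nonneg hk (sq_nonneg (q ^ 3 / u)), mul_nonneg hk h0.le]
  linarith

/-- Both factors give up a 3, while the sum has remainder 2 and gives up none: (q^4 / u)^2 = q^2
ρ^2. The binomial coefficient and (i+1)(j+1) are each at most 2^(i+j), so 4^(i+j) ρ^2 < 2 is enough.
-/
theorem apply_mul_apply_lt_one_one (h : CubeDominated N x u q) {i j : ℕ} (hij : 1 ≤ i + j)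
    (hρ : (q ^ 3 / u) ^ 2 * (4 * 24 ^ (i + j)) ≤ 37) :
    N (3 * i + 1) * N (3 * j + 1) < N (3 * (i + j) + 2) := by
  have hu := h.u_pos
  have hq := h.q_pos
  have h0 : 0 < q ^ 3 / u := by positivity
  have hside : ∀ m : ℕ, m ≤ i + j → ((m : ℝ) - 1) * (q ^ 3 / u) ≤ 1 / 4 := by
    intro m hm
    obtain ⟨n, hn⟩ : ∃ n, i + j = n + 1 := ⟨i + j - 1, by omega⟩
    have hm' : (m : ℝ) ≤ n + 1 := by exact_mod_cast hm.trans hn.le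
    rw [hn] at hρ
    have h1 := mul_sq_le_pow n
    have h2 : (n * (q ^ 3 / u)) ^ 2 ≤ (1 / 4) ^ 2 := by
      rw [mul_pow]
      nlinarith [mul_le_mul_of_nonneg_right h1 (sq_nonneg (q ^ 3 / u))]
    have h3 := le_of_sq_le_sq h2 (by norm_num)
    nlinarith
  have hi := h.apply_three_mul_add_one_le i (hside i (by omega))
  have hj := h.apply_three_mul_add_one_le j (hside j (by omega))
  refine (mul_le_mul hi hj (h.nonneg _) (by positivity)).trans_lt
    (lt_of_lt_of_le ?_ (h.le_apply (i + j) 2))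
  rw [h.x_two]
  have hf : (1 : ℝ) / (i.factorial * j.factorial) ≤ 2 ^ (i + j) / (i + j).factorial := by
    rw [div_le_div_iff₀ (by positivity) (by positivity)]
    linarith [factorial_le_two_pow_mul i j]
  have hpow : (4 : ℝ) ^ (i + j) * (q ^ 3 / u) ^ 2 < 2 := by
    have h6 : (6 : ℝ) ≤ 6 ^ (i + j) := by
      simpa using pow_le_pow_right₀ (by norm_num : (1 : ℝ) ≤ 6) hij
    have h24 : (24 : ℝ) ^ (i + j) = 6 ^ (i + j) * 4 ^ (i + j) := by rw [← mul_pow]; norm_num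
    have h4 : 0 < (4 : ℝ) ^ (i + j) * (q ^ 3 / u) ^ 2 := by positivity
    rw [h24] at hρ
    nlinarith
  calc _ = (u ^ (i + j) * q ^ 2 * (q ^ 3 / u) ^ 2 / 4) * (((i : ℝ) + 1) * (j + 1)) *
        (1 / (i.factorial * j.factorial)) := by rw [pow_add]; field_simp; ring
    _ ≤ (u ^ (i + j) * q ^ 2 * (q ^ 3 / u) ^ 2 / 4) * (2 ^ i * 2 ^ j) *
        (2 ^ (i + j) / (i + j).factorial) := by
        gcongr
        · exact add_one_le_two_pow i
        · exact add_one_le_two_pow j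
    _ = u ^ (i + j) / (i + j).factorial * q ^ 2 * (4 ^ (i + j) * (q ^ 3 / u) ^ 2 / 4) := by
        rw [← pow_add, show (4 : ℝ) = 2 * 2 by norm_num, mul_pow 2 2]
        ring
    _ < u ^ (i + j) / (i + j).factorial * q ^ 2 * (1 / 2) :=
        mul_lt_mul_of_pos_left (by linarith) (by positivity)
    _ = _ := by ring

/-- The remainders combine to one more 3, and (q^4 / u) q^2 = u ρ^2. Three factors of size at most
2^(i+j) arise: i + 1, the binomial coefficient, and i + j + 1 from the larger factorial. -/
theorem apply_mul_apply_lt_one_two (h : CubeDominated N x u q) {i j : ℕ} (hi1 : 1 ≤ i)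
    (hρ : (q ^ 3 / u) ^ 2 * 24 ^ (i + j + 1) ≤ 37) :
    N (3 * i + 1) * N (3 * j + 2) < N (3 * (i + j + 1)) := by
  have hu := h.u_pos
  have hq := h.q_pos
  have h0 : 0 < q ^ 3 / u := by positivity
  have hside : ∀ m : ℕ, m ≤ i + j → (m * (q ^ 3 / u)) ≤ 1 / 2 := by
    intro m hm
    have h1 := mul_sq_le_pow (i + j)
    have hm' : (m : ℝ) ≤ (i + j : ℕ) := by exact_mod_cast hm
    have h2 : ((i + j : ℕ) * (q ^ 3 / u)) ^ 2 ≤ (1 / 2) ^ 2 := by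
      rw [mul_pow]
      nlinarith [mul_le_mul_of_nonneg_right h1 (sq_nonneg (q ^ 3 / u))]
    have h3 := le_of_sq_le_sq h2 (by norm_num)
    nlinarith
  have hside' : ∀ m : ℕ, m ≤ i + j → ((m : ℝ) - 1) * (q ^ 3 / u) ≤ 1 / 4 := by
    intro m hm
    obtain ⟨n, hn⟩ : ∃ n, i + j = n + 1 := ⟨i + j - 1, by omega⟩
    have hm' : (m : ℝ) ≤ n + 1 := by exact_mod_cast hm.trans hn.le
    rw [hn, pow_succ 24] at hρ
    have h1 := mul_sq_le_pow n
    have h2 : (n * (q ^ 3 / u)) ^ 2 ≤ (1 / 4) ^ 2 := by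
      rw [mul_pow]
      nlinarith [mul_le_mul_of_nonneg_right h1 (sq_nonneg (q ^ 3 / u))]
    have h3 := le_of_sq_le_sq h2 (by norm_num)
    nlinarith
  have hi := h.apply_three_mul_add_one_le i (hside' i (by omega))
  have hj := h.apply_three_mul_add_two_le j (by nlinarith [hside' j (by omega)])
    ((hside j (by omega)).trans (by norm_num))
  refine (mul_le_mul hi hj (h.nonneg _) (by positivity)).trans_lt
    (lt_of_lt_of_le ?_ (h.le_apply (i + j + 1) 0))
  rw [h.x_zero, pow_zero, mul_one, mul_one]
  have hf : (1 : ℝ) / (i.factorial * j.factorial) ≤ 2 ^ (i + j) / (i + j).factorial := by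
    rw [div_le_div_iff₀ (by positivity) (by positivity)]
    linarith [factorial_le_two_pow_mul i j]
  have hpow : (8 : ℝ) ^ (i + j) * (q ^ 3 / u) ^ 2 < 2 := by
    have h6 : (1 : ℝ) ≤ 3 ^ (i + j) := one_le_pow₀ (by norm_num)
    have h24 : (24 : ℝ) ^ (i + j) = 3 ^ (i + j) * 8 ^ (i + j) := by rw [← mul_pow]; norm_num
    have h4 : 0 < (8 : ℝ) ^ (i + j) * (q ^ 3 / u) ^ 2 := by positivity
    rw [pow_succ 24, h24] at hρ
    nlinarith
  have hi2 : (i : ℝ) + 1 ≤ 2 ^ (i + j) :=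
    (add_one_le_two_pow i).trans (pow_le_pow_right₀ (by norm_num) (by omega))
  calc _ = (u ^ (i + j + 1) * (q ^ 3 / u) ^ 2 / 2) * ((i : ℝ) + 1) *
        (1 / (i.factorial * j.factorial)) := by rw [pow_succ, pow_add]; field_simp; ring
    _ ≤ (u ^ (i + j + 1) * (q ^ 3 / u) ^ 2 / 2) * 2 ^ (i + j) *
        (2 ^ (i + j) / (i + j).factorial) := by gcongr
    _ = (u ^ (i + j + 1) * (q ^ 3 / u) ^ 2 / 2) * 2 ^ (i + j) *
        (2 ^ (i + j) * ((i + j : ℕ) + 1) / (i + j + 1).factorial) := by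
        rw [Nat.factorial_succ]
        push_cast
        field_simp
    _ ≤ (u ^ (i + j + 1) * (q ^ 3 / u) ^ 2 / 2) * 2 ^ (i + j) *
        (2 ^ (i + j) * 2 ^ (i + j) / (i + j + 1).factorial) := by
        gcongr
        exact add_one_le_two_pow (i + j)
    _ = u ^ (i + j + 1) / (i + j + 1).factorial * (8 ^ (i + j) * (q ^ 3 / u) ^ 2 / 2) := by
        rw [show (8 : ℝ) = 2 * 2 * 2 by norm_num, mul_pow (2 * 2 : ℝ) 2, mul_pow (2 : ℝ) 2]
        ring
    _ < u ^ (i + j + 1) / (i + j + 1).factorial :=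
        mul_lt_of_lt_one_right (by positivity) (by linarith)

end CubeDominated

/-! ### From the logarithmic hypotheses to bounds on the ratio -/

lemma le_pow_of_logb_le {ℓ : ℕ} {Y : ℝ} (hY : 0 < Y) (h : Real.logb (9 / 8) Y ≤ ℓ) :
    Y ≤ (9 / 8) ^ ℓ := by
  rwa [Real.logb_le_iff_le_rpow (by norm_num) hY, Real.rpow_natCast] at h

lemma logb_nine_eighths_nonneg {y : ℝ} (hy : 1 ≤ y) : 0 ≤ Real.logb (9 / 8) y :=
  Real.logb_nonneg (by norm_num) hy

lemma one_le_logb_seven_sixths : 1 ≤ Real.logb (9 / 8) (7 / 6) := by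
  rw [Real.le_logb_iff_rpow_le (by norm_num) (by norm_num), Real.rpow_one]
  norm_num

lemma sixteen_mul_sq_mul_sq_le {K : ℕ} (hK : 2 ≤ K) :
    16 * ((K : ℝ) ^ 2 * (K - 1) ^ 2) ≤ 4 ^ K * K ^ K := by
  have h1 : (4 : ℝ) * (K - 1) ≤ 2 ^ K := by
    induction K, hK using Nat.le_induction with
    | base => norm_num
    | succ K hK ih =>
      have : (2 : ℝ) ≤ K := by exact_mod_cast hK
      rw [pow_succ]
      push_cast
      linarith
  have hK' : (2 : ℝ) ≤ K := by exact_mod_cast hK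
  have h2 : (K : ℝ) ^ 2 ≤ K ^ K := pow_le_pow_right₀ (by linarith) hK
  have h3 : 16 * ((K : ℝ) - 1) ^ 2 ≤ 4 ^ K := by
    have : (4 : ℝ) ^ K = 2 ^ K * 2 ^ K := by rw [← mul_pow]; norm_num
    rw [this]
    nlinarith
  calc 16 * ((K : ℝ) ^ 2 * (K - 1) ^ 2) = (16 * ((K : ℝ) - 1) ^ 2) * K ^ 2 := by ring
    _ ≤ 4 ^ K * (K : ℝ) ^ K := by gcongr

/-- The lower bound on `ℓ` under which the main terms dominate. -/
lemma le_and_ratio_le {ℓ K : ℕ} (hK : 2 ≤ K)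
    (h : 18 * ((K : ℝ) ^ 2 * (K - 1) ^ 2) ≤ (9 / 8) ^ ℓ) :
    36 ≤ ℓ ∧ K * (K - 1) * ((√2 ^ ℓ) ^ 3 / cubeWeight ℓ) ≤ 36 / 25 := by
  have hK' : (2 : ℝ) ≤ K := by exact_mod_cast hK
  have hP : 2 ≤ (K : ℝ) * (K - 1) := by nlinarith
  -- The value 72 is the case K = 2 of the hypothesis; since (9/8)^36 < 72, it forces `ℓ` ≥ 36.
  have h72 : (72 : ℝ) ≤ (9 / 8) ^ ℓ := by nlinarith
  have hℓ : 36 ≤ ℓ := by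
    by_contra! hc
    have : (9 / 8 : ℝ) ^ ℓ ≤ (9 / 8) ^ 36 := pow_le_pow_right₀ (by norm_num) hc.le
    norm_num at this
    linarith
  refine ⟨hℓ, le_of_sq_le_sq ?_ (by norm_num)⟩
  have hr := ratio_sq_le hℓ
  have hX : (8 / 9 : ℝ) ^ ℓ * (9 / 8) ^ ℓ = 1 := by rw [← mul_pow]; norm_num
  have h8 : (0 : ℝ) < (8 / 9) ^ ℓ := by positivity
  have h1 : (8 / 9 : ℝ) ^ ℓ * (18 * ((K : ℝ) ^ 2 * (K - 1) ^ 2)) ≤ 1 :=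
    (mul_le_mul_of_nonneg_left h h8.le).trans_eq hX
  calc (K * ((K : ℝ) - 1) * ((√2 ^ ℓ) ^ 3 / cubeWeight ℓ)) ^ 2
      = (K : ℝ) ^ 2 * (K - 1) ^ 2 * ((√2 ^ ℓ) ^ 3 / cubeWeight ℓ) ^ 2 := by ring
    _ ≤ (K : ℝ) ^ 2 * (K - 1) ^ 2 * (37 * (8 / 9) ^ ℓ) := by gcongr
    -- The constant 36/25 is chosen so that its square exceeds 37/18.
    _ ≤ (36 / 25) ^ 2 := by linarith

lemma le_and_ratio_le_of_logb {ℓ K : ℕ} (hK : 2 ≤ K)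
    (h : 1 + K * Real.logb (9 / 8) 4 + K * Real.logb (9 / 8) K ≤ ℓ) :
    36 ≤ ℓ ∧ K * (K - 1) * ((√2 ^ ℓ) ^ 3 / cubeWeight ℓ) ≤ 36 / 25 := by
  have hK' : (0 : ℝ) < K := by positivity
  -- The summand 1 in the hypothesis is the factor 9/8, which raises 16 to the required 18.
  refine le_and_ratio_le hK (le_trans ?_
    (le_pow_of_logb_le (Y := 9 / 8 * 4 ^ K * K ^ K) (by positivity) (le_of_eq_of_le ?_ h)))
  · linarith [sixteen_mul_sq_mul_sq_le hK]
  · rw [Real.logb_mul (by positivity) (by positivity), Real.logb_mul (by norm_num) (by positivity),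
      Real.logb_pow, Real.logb_pow, Real.logb_self_eq_one (by norm_num)]

lemma le_and_ratio_le_of_logb_two {ℓ K : ℕ} (hK : 2 ≤ K)
    (h : (4 * K + 4) * Real.logb (9 / 8) 2 ≤ ℓ) :
    36 ≤ ℓ ∧ K * (K - 1) * ((√2 ^ ℓ) ^ 3 / cubeWeight ℓ) ≤ 36 / 25 := by
  refine le_and_ratio_le hK (le_trans ?_
    (le_pow_of_logb_le (Y := 2 ^ (4 * K + 4)) (by positivity) (le_of_eq_of_le ?_ h)))
  · have h1 : (K : ℝ) ≤ 2 ^ K := by exact_mod_cast (Nat.lt_two_pow_self : K < 2 ^ K).le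
    obtain ⟨m, rfl⟩ : ∃ m, K = m + 1 := ⟨K - 1, by omega⟩
    have h2 : (m : ℝ) ≤ 2 ^ m := by exact_mod_cast (Nat.lt_two_pow_self : m < 2 ^ m).le
    calc 18 * (((m + 1 : ℕ) : ℝ) ^ 2 * ((m + 1 : ℕ) - 1) ^ 2)
        = 18 * (((m + 1 : ℕ) : ℝ) ^ 2 * (m : ℝ) ^ 2) := by push_cast; ring
      _ ≤ 18 * ((2 ^ (m + 1)) ^ 2 * (2 ^ m) ^ 2) := by gcongr
      _ = 72 / 256 * 2 ^ (4 * (m + 1) + 4) := by ring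
      _ ≤ 2 ^ (4 * (m + 1) + 4) := by
        have : (0 : ℝ) < 2 ^ (4 * (m + 1) + 4) := by positivity
        linarith
  · rw [Real.logb_pow]
    push_cast
    rfl

lemma ratio_sq_mul_le {ℓ : ℕ} (hℓ : 36 ≤ ℓ) {Y : ℝ} (hY : Y ≤ (9 / 8) ^ ℓ) :
    ((√2 ^ ℓ) ^ 3 / cubeWeight ℓ) ^ 2 * Y ≤ 37 := by
  have hX : (8 / 9 : ℝ) ^ ℓ * (9 / 8) ^ ℓ = 1 := by rw [← mul_pow]; norm_num
  calc _ ≤ ((√2 ^ ℓ) ^ 3 / cubeWeight ℓ) ^ 2 * (9 / 8) ^ ℓ := by gcongr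
    _ ≤ 37 * (8 / 9) ^ ℓ * (9 / 8) ^ ℓ := by
        gcongr
        exact ratio_sq_le hℓ
    _ = 37 := by rw [mul_assoc, hX, mul_one]

/-- (9/8)^27 just exceeds 24, and 27 is what 9(a + b) gains when i + j grows by 1. -/
lemma twentyfour_pow_le (m : ℕ) : (24 : ℝ) ^ m ≤ (9 / 8) ^ (27 * m) := by
  rw [pow_mul]
  exact pow_le_pow_left₀ (by norm_num) (by norm_num) m

/-! ### The six residue cases -/

theorem mainTheorem2 (a b ℓ : ℕ) (ha : 1 ≤ a) (hb : 2 ≤ b) :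
    (b ≡ 0 [MOD 3] → a ≡ 0 [MOD 3] →
      (ℓ : ℝ) > 1 + ((a : ℝ) + b) / 3 * Real.logb (9 / 8) (4 * (((a : ℝ) + b) / 3)) →
      0 < bessenrodtOnoDelta ℓ a b) ∧
    (b ≡ 1 [MOD 3] → 4 < b → a ≡ 0 [MOD 3] →
      (ℓ : ℝ) ≥ Real.logb (9 / 8) (7 / 6)
        + ((a : ℝ) + b - 2) / 3 * Real.logb (9 / 8) 4
        + ((a : ℝ) + b - 4) / 3 * Real.logb (9 / 8) (((a : ℝ) + b - 4) / 3) →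
      0 < bessenrodtOnoDelta ℓ a b) ∧
    (b ≡ 1 [MOD 3] → 1 < b → a ≡ 1 [MOD 3] →
      (ℓ : ℝ) ≥ -6 + 9 * ((a : ℝ) + b)
        + (((a : ℝ) + b) / 2 + 2) / 3 * Real.logb (9 / 8) (((a : ℝ) + b - 2) / 3) →
      bessenrodtOnoDelta ℓ a b < 0) ∧
    (b ≡ 2 [MOD 3] → 2 < b → a ≡ 0 [MOD 3] →
      (ℓ : ℝ) ≥ 1 + ((a : ℝ) + b - 1) / 3 * Real.logb (9 / 8) 4
        + ((a : ℝ) + b - 2) / 3 * Real.logb (9 / 8) (((a : ℝ) + b - 2) / 3) →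
      0 < bessenrodtOnoDelta ℓ a b) ∧
    (b ≡ 2 [MOD 3] → a ≡ 1 [MOD 3] → 1 < a →
      (ℓ : ℝ) ≥ 5 + 9 * ((a : ℝ) + b)
        + (((a : ℝ) + b) / 2 + 4) / 3 * Real.logb (9 / 8) (((a : ℝ) + b) / 3) →
      bessenrodtOnoDelta ℓ a b < 0) ∧
    (b ≡ 2 [MOD 3] → 2 < a → 2 < b → a ≡ 2 [MOD 3] →
      (ℓ : ℝ) ≥ 1 + Real.logb (9 / 8) (7 / 6)
        + (((a : ℝ) + b - 4) / 3 + ((a : ℝ) + b)) * Real.logb (9 / 8) 2 →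
      0 < bessenrodtOnoDelta ℓ a b) := by
  have h4 := logb_nine_eighths_nonneg (y := 4) (by norm_num)
  have h2 := logb_nine_eighths_nonneg (y := 2) (by norm_num)
  have h76 := one_le_logb_seven_sixths
  unfold Nat.ModEq
  simp only [bessenrodtOnoDelta, sub_pos, sub_neg]
  refine ⟨fun hbm ham h => ?_, fun hbm hb4 ham h => ?_, fun hbm hb1 ham h => ?_,
    fun hbm hb2 ham h => ?_, fun hbm ham ha1 h => ?_, fun hbm ha2 hb2 ham h => ?_⟩
  · obtain ⟨i, rfl⟩ : ∃ i, a = 3 * i := ⟨a / 3, by omega⟩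
    obtain ⟨j, rfl⟩ : ∃ j, b = 3 * j := ⟨b / 3, by omega⟩
    have hn : (((3 * i : ℕ) : ℝ) + (3 * j : ℕ)) / 3 = (i + j : ℕ) := by push_cast; ring
    have hK : (0 : ℝ) < (i + j : ℕ) := by
      have : 0 < i + j := by omega
      exact_mod_cast this
    rw [hn, Real.logb_mul (by norm_num) hK.ne'] at h
    obtain ⟨hℓ, hρ⟩ := le_and_ratio_le_of_logb (ℓ := ℓ) (K := i + j) (by omega) (by linarith)
    obtain ⟨x, hx⟩ := exists_cubeDominated hℓ
    rw [← mul_add]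
    exact hx.apply_add_lt_zero_zero (by omega) (by omega) hρ
  · obtain ⟨i, rfl⟩ : ∃ i, a = 3 * i := ⟨a / 3, by omega⟩
    -- Residue 1 is written with remainder 4, the remainder of its main term; b > 4 makes j ≥ 1.
    obtain ⟨j, rfl⟩ : ∃ j, b = 3 * j + 4 := ⟨(b - 4) / 3, by omega⟩
    have hn : (((3 * i : ℕ) : ℝ) + (3 * j + 4 : ℕ) - 4) / 3 = (i + j : ℕ) := by push_cast; ring
    have hn' : (((3 * i : ℕ) : ℝ) + (3 * j + 4 : ℕ) - 2) / 3 = (i + j : ℕ) + 2 / 3 := by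
      push_cast; ring
    rw [hn, hn'] at h
    obtain ⟨hℓ, hρ⟩ := le_and_ratio_le_of_logb (ℓ := ℓ) (K := i + j) (by omega) (by linarith)
    obtain ⟨x, hx⟩ := exists_cubeDominated hℓ
    rw [← add_assoc, ← mul_add]
    exact hx.apply_add_lt_zero_four (by omega) (by omega) hρ
  · obtain ⟨i, rfl⟩ : ∃ i, a = 3 * i + 1 := ⟨a / 3, by omega⟩
    obtain ⟨j, rfl⟩ : ∃ j, b = 3 * j + 1 := ⟨b / 3, by omega⟩
    have hn : (((3 * i + 1 : ℕ) : ℝ) + (3 * j + 1 : ℕ) - 2) / 3 = (i + j : ℕ) := by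
      push_cast; ring
    have hK : (1 : ℝ) ≤ (i + j : ℕ) := by
      have : 1 ≤ i + j := by omega
      exact_mod_cast this
    rw [hn] at h
    have hlog := logb_nine_eighths_nonneg hK
    have hpos : 0 ≤ ((((3 * i + 1 : ℕ) : ℝ) + (3 * j + 1 : ℕ)) / 2 + 2) / 3 *
        Real.logb (9 / 8) (i + j : ℕ) := by positivity
    -- The logarithmic term is only used as nonnegative: 9(a + b) - 6 = 27(i + j) + 12, and (9/8)^12
    -- ≥ 4 supplies the factor 4 below.
    have hℓ : 27 * (i + j) + 12 ≤ ℓ := by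
      have : (27 * ((i + j : ℕ) : ℝ) + 12) ≤ ℓ := by
        push_cast at h hpos ⊢
        linarith
      exact_mod_cast this
    obtain ⟨x, hx⟩ := exists_cubeDominated (ℓ := ℓ) (by omega)
    have hX : (4 : ℝ) * 24 ^ (i + j) ≤ (9 / 8) ^ ℓ := by
      refine le_trans ?_ (pow_le_pow_right₀ (by norm_num) hℓ)
      rw [pow_add _ (27 * (i + j)) 12, mul_comm (4 : ℝ)]
      exact mul_le_mul (twentyfour_pow_le _) (by norm_num) (by norm_num) (by positivity)
    rw [show 3 * i + 1 + (3 * j + 1) = 3 * (i + j) + 2 by ring]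
    exact hx.apply_mul_apply_lt_one_one (by omega) (ratio_sq_mul_le (by omega) hX)
  · obtain ⟨i, rfl⟩ : ∃ i, a = 3 * i := ⟨a / 3, by omega⟩
    obtain ⟨j, rfl⟩ : ∃ j, b = 3 * j + 2 := ⟨b / 3, by omega⟩
    have hn : (((3 * i : ℕ) : ℝ) + (3 * j + 2 : ℕ) - 2) / 3 = (i + j : ℕ) := by push_cast; ring
    have hn' : (((3 * i : ℕ) : ℝ) + (3 * j + 2 : ℕ) - 1) / 3 = (i + j : ℕ) + 1 / 3 := by
      push_cast; ring
    rw [hn, hn'] at h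
    obtain ⟨hℓ, hρ⟩ := le_and_ratio_le_of_logb (ℓ := ℓ) (K := i + j) (by omega) (by linarith)
    obtain ⟨x, hx⟩ := exists_cubeDominated hℓ
    rw [← add_assoc, ← mul_add]
    exact hx.apply_add_lt_zero_two (by omega) (by omega) hρ
  · obtain ⟨i, rfl⟩ : ∃ i, a = 3 * i + 1 := ⟨a / 3, by omega⟩
    obtain ⟨j, rfl⟩ : ∃ j, b = 3 * j + 2 := ⟨b / 3, by omega⟩
    have hn : (((3 * i + 1 : ℕ) : ℝ) + (3 * j + 2 : ℕ)) / 3 = (i + j + 1 : ℕ) := by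
      push_cast; ring
    have hK : (1 : ℝ) ≤ (i + j + 1 : ℕ) := by
      have : 1 ≤ i + j + 1 := by omega
      exact_mod_cast this
    rw [hn] at h
    have hlog := logb_nine_eighths_nonneg hK
    have hpos : 0 ≤ ((((3 * i + 1 : ℕ) : ℝ) + (3 * j + 2 : ℕ)) / 2 + 4) / 3 *
        Real.logb (9 / 8) (i + j + 1 : ℕ) := by positivity
    have hℓ : 27 * (i + j + 1) ≤ ℓ := by
      have : (27 * ((i + j + 1 : ℕ) : ℝ)) ≤ ℓ := by
        push_cast at h hpos ⊢
        linarith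
      exact_mod_cast this
    obtain ⟨x, hx⟩ := exists_cubeDominated (ℓ := ℓ) (by omega)
    have hX : (24 : ℝ) ^ (i + j + 1) ≤ (9 / 8) ^ ℓ :=
      (twentyfour_pow_le _).trans (pow_le_pow_right₀ (by norm_num) hℓ)
    rw [show 3 * i + 1 + (3 * j + 2) = 3 * (i + j + 1) by ring]
    exact hx.apply_mul_apply_lt_one_two (by omega) (ratio_sq_mul_le (by omega) hX)
  · obtain ⟨i, rfl⟩ : ∃ i, a = 3 * i + 2 := ⟨a / 3, by omega⟩
    obtain ⟨j, rfl⟩ : ∃ j, b = 3 * j + 2 := ⟨b / 3, by omega⟩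
    -- With K = i + j, a + b = 3K + 4, so the coefficient of the logarithm is K + (3K + 4).
    have hn : (((3 * i + 2 : ℕ) : ℝ) + (3 * j + 2 : ℕ) - 4) / 3 +
        (((3 * i + 2 : ℕ) : ℝ) + (3 * j + 2 : ℕ)) = 4 * (i + j : ℕ) + 4 := by
      push_cast; ring
    rw [hn] at h
    obtain ⟨hℓ, hρ⟩ := le_and_ratio_le_of_logb_two (ℓ := ℓ) (K := i + j) (by omega) (by linarith)
    obtain ⟨x, hx⟩ := exists_cubeDominated hℓ
    rw [show 3 * i + 2 + (3 * j + 2) = 3 * (i + j) + 4 by ring]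
    exact hx.apply_add_lt_two_two (by omega) (by omega) hρ
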